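/- **Definitions.** For a finite undirected $d$-regular simple graph $G=(V,E)$ and $\emptyset\ne S\subseteq V$ let $\Phi(S)=\frac{|\{(v,u): v\sim u,\ v\in S,\ u\notin S\}|}{|\{(v,u): v\sim u,\ v\in S\}|}$. $G$ is $(\varepsilon,\gamma)$ small-set expanding if $\Phi(S)\ge\gamma$ for every nonempty $S\subseteq V$ with $|S|\le\varepsilon|V|$. In a two-player game $\Psi$ with finite question sets $X,Y$, question pairs $E\subseteq X\times Y$ and finite answer sets $A,B$, a pair $(x,y)\in E$ is drawn uniformly, Alice answers $f(x)\in A$, Bob answers $g(y)\in B$, and they win if $(f(x),g(y))\in\phi_{(x,y)}$, where $\phi_{(x,y)}\subseteq A\times B$ is the constraint of the edge $(x,y)$. The value $\mathsf{val}(\Psi)$ is the maximum winning probability over all pairs $f\colon X\to A$, $g\colon Y\to B$. In the $t$-fold repetition $\Psi^{\otimes t}$ the question pairs are the $((x_1,\dots,x_t),(y_1,\dots,y_t))\in X^t\times Y^t$ with $(x_i,y_i)\in E$ for all $i$, the answers lie in $A^t$ and $B^t$, and the constraint is the conjunction of the $t$ constraints on the coordinates. - A *Unique-Games instance* on $G=(V,E)$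 with finite alphabet $\Sigma$ is the game with $X=Y=V$, $A=B=\Sigma$, in which $(u,v)$ is a uniformly random ordered pair of adjacent vertices and every constraint $\phi_{(u,v)}\subseteq\Sigma\times\Sigma$ is a one-to-one relation. - A *projection game* is a game in which, for every $(x,y)\in E$, there is a (possibly partial) function $\pi_{x,y}$ from $A$ to $B$ such that $(a,b)\in\phi_{(x,y)}$ if and only if $\pi_{x,y}(a)=b$. Its graph is the bipartite graph on $X\sqcup Y$ with edge set $E$. **Theorem.** There is an absolute constant $c>0$ such that the following holds for all $0<\varepsilon,\gamma,\delta<1$. Let $\Psi$ be either a Unique-Games instance on a regular, $(\varepsilon,\gamma)$ small-set expanding graph, or a projection game whose bipartite graph is regular and $(\varepsilon,\gamma)$ small-set expanding. If $\mathsf{val}(\Psi)\le 1-\delta$, then for every $t\in\mathbb N$ $$\mathsf{val}(\Psi^{\otimes t})\le(1-\delta)^{c\,\varepsilon^3\gamma^3\,t}.$$ -/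

import Mathlib

noncomputable section

/-- The edge expansion `Φ(S)`: among the pairs `(v, u)` of adjacent vertices with `v ∈ S`,
the fraction of those with `u ∉ S`. -/
def edgeExpansion {V : Type*} [Fintype V] (G : SimpleGraph V) (S : Finset V) : ℝ :=
  (Set.ncard {p : V × V | G.Adj p.1 p.2 ∧ p.1 ∈ S ∧ p.2 ∉ S} : ℝ) /
    (Set.ncard {p : V × V | G.Adj p.1 p.2 ∧ p.1 ∈ S} : ℝ)

/-- `G` is `(ε, γ)` small-set expanding: every nonempty set of at most `ε |V|` vertices has
edge expansion at least `γ`. -/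
def IsSmallSetExpander {V : Type*} [Fintype V] (G : SimpleGraph V) (ε γ : ℝ) : Prop :=
  ∀ S : Finset V, S.Nonempty → (S.card : ℝ) ≤ ε * (Fintype.card V : ℝ) → γ ≤ edgeExpansion G S

/-- A two-player one-round game. The referee draws `(x, y)` uniformly from the set `edges` of
question pairs and sends `x` to Alice, `y` to Bob; they answer `a` and `b` without
communicating and win if `accept x y a b`. -/
structure TwoPlayerGame (X Y A B : Type*) where
  edges : Set (X × Y)
  accept : X → Y → A → B → Prop

namespace TwoPlayerGame

variable {X Y A B : Type*}

/-- The probability that the strategies `f` (Alice) and `g` (Bob) win, that is, the fraction of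
constraints satisfied by the labelling that `f` and `g` form together. -/
def winProb (Ψ : TwoPlayerGame X Y A B) (f : X → A) (g : Y → B) : ℝ :=
  (Set.ncard {q ∈ Ψ.edges | Ψ.accept q.1 q.2 (f q.1) (g q.2)} : ℝ) / (Ψ.edges.ncard : ℝ)

/-- The value of the game: the maximum winning probability over all pairs of strategies. -/
def value (Ψ : TwoPlayerGame X Y A B) : ℝ :=
  ⨆ s : (X → A) × (Y → B), Ψ.winProb s.1 s.2

/-- The `t`-fold parallel repetition `Ψ^{⊗ t}`: `t` independent question pairs are asked at
once, and the players win if they win in all `t` coordinates. -/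
def repetition (Ψ : TwoPlayerGame X Y A B) (t : ℕ) :
    TwoPlayerGame (Fin t → X) (Fin t → Y) (Fin t → A) (Fin t → B) where
  edges := {q | ∀ i, (q.1 i, q.2 i) ∈ Ψ.edges}
  accept x y a b := ∀ i, Ψ.accept (x i) (y i) (a i) (b i)

/-- The bipartite graph of the game, with the questions of Alice on one side and those of Bob
on the other. -/
def graph (Ψ : TwoPlayerGame X Y A B) : SimpleGraph (X ⊕ Y) :=
  SimpleGraph.fromRel fun p q => ∃ e ∈ Ψ.edges, p = Sum.inl e.1 ∧ q = Sum.inr e.2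

/-- A projection game: on each edge, the constraint says `b = π a` for a function `π`
from the answers of Alice to those of Bob. The function may be partial (an answer `a` outside
its domain loses), so that games with one-to-one relations are included; the usual projection
games are those in which it is total. -/
def IsProjection (Ψ : TwoPlayerGame X Y A B) : Prop :=
  ∀ x y, (x, y) ∈ Ψ.edges → ∃ π : A → Option B, ∀ a b, Ψ.accept x y a b ↔ π a = some b

end TwoPlayerGame

/-- A Unique-Games instance on the graph `G` with alphabet `A`: for each pair `(u, v)` of
adjacent vertices a one-to-one relation `constraint u v` on the alphabet. (A constraint attached
to an undirected edge is the case in which `constraint v u` is the converse of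
`constraint u v`.) -/
structure UniqueGame {V : Type*} (G : SimpleGraph V) (A : Type*) where
  constraint : V → V → A → A → Prop
  right_unique : ∀ u v, G.Adj u v → ∀ a b b', constraint u v a b → constraint u v a b' → b = b'
  left_unique : ∀ u v, G.Adj u v → ∀ a a' b, constraint u v a b → constraint u v a' b → a = a'

/-- The two-player game of a Unique-Games instance: `(u, v)` is a uniformly random pair of
adjacent vertices, Alice labels `u`, Bob labels `v`. -/
def UniqueGame.game {V : Type*} {G : SimpleGraph V} {A : Type*} (Ψ : UniqueGame G A) :
    TwoPlayerGame V V A A where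
  edges := {q | G.Adj q.1 q.2}
  accept := Ψ.constraint

end

/-!
By Cauchy-Schwarz, the value of a projection game is controlled by its collision value, in which
Alice alone is asked two questions with a common neighbour. The collision value extends to vector
labellings, whose labels at a question carry vectors of total length at most one, and a bound valid
for all vector labellings multiplies under repetition: fixing all coordinates but one turns a
labelling of the repeated game into a vector labelling of the original game.

Vector labellings are rounded to ordinary strategies by correlated sampling: neighbouring questions
select the same coordinate `ω` of their vectors with high probability. Sampling with the squares of
the vector entries always works, with a quadratic loss, which suffices when `1 - δ` is small. On a
small-set expander the loss becomes linear in `1 / (ε * γ)` if the squares are replaced by a profile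
`ψ` of the entries that stays comparable with the square but is flat near `O(1 / ε)` breakpoints.
The breakpoints cut the vertices into cells of at most a fraction `ε` each, in which small-set
expansion gives a Cheeger-type bound on how often `ψ` separates neighbours.

A Unique-Games instance is a projection game on the bipartite double cover of its graph, which is
again a small-set expander.
-/
open Finset Matrix

section Layers

variable {W : Type*} [DecidableEq W]

theorem exists_layers [Finite W] (φ : W → ℝ) (hφ : ∀ w, 0 ≤ φ w) :
    ∃ (n : ℕ) (S : Fin n → Finset W) (m : Fin n → ℝ), (∀ i, 0 < m i) ∧ (∀ i, (S i).Nonempty) ∧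
      (∀ i, ∀ w ∈ S i, 0 < φ w) ∧
      ∀ w w', min (φ w) (φ w') = ∑ i, if w ∈ S i ∧ w' ∈ S i then m i else 0 := by
  cases nonempty_fintype W
  induction h : #{w | 0 < φ w} using Nat.strong_induction_on generalizing φ with
  | _ N ih =>
    subst h
    set S : Finset W := {w | 0 < φ w} with hS
    have mem_S : ∀ w, w ∈ S ↔ 0 < φ w := by simp [hS]
    have eq_zero : ∀ w ∉ S, φ w = 0 := fun w hw =>
      le_antisymm (not_lt.1 fun h => hw ((mem_S w).2 h)) (hφ w)
    rcases S.eq_empty_or_nonempty with hS₀ | hS₀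
    · have hφ₀ : ∀ w, φ w = 0 := fun w => eq_zero w (by simp [hS₀])
      exact ⟨0, nofun, nofun, nofun, nofun, nofun, fun w w' => by simp [hφ₀]⟩
    obtain ⟨w₀, hw₀, hmin⟩ := S.exists_min_image φ hS₀
    have hpos : 0 < φ w₀ := (mem_S w₀).1 hw₀
    let rest : W → ℝ := fun w => if w ∈ S then φ w - φ w₀ else 0
    have rest_nonneg : ∀ w, 0 ≤ rest w := fun w => by
      by_cases hw : w ∈ S
      · simpa [rest, hw] using hmin w hw
      · simp [rest, hw]
    have pos_of_rest : ∀ w, 0 < rest w → w ∈ S := fun w h => by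
      by_contra hw
      simp [rest, hw] at h
    have hcard : #{w | 0 < rest w} < #S := by
      refine card_lt_card ((ssubset_iff_of_subset fun w hw => ?_).2 ⟨w₀, hw₀, by simp [rest]⟩)
      exact pos_of_rest w (by simpa using hw)
    obtain ⟨n, T, m, hm, hT, hTpos, hsum⟩ := ih _ hcard rest rest_nonneg rfl
    refine ⟨n + 1, Fin.cons S T, Fin.cons (φ w₀) m, Fin.forall_fin_succ.2 ⟨hpos, hm⟩,
      Fin.forall_fin_succ.2 ⟨hS₀, hT⟩, Fin.forall_fin_succ.2 ⟨fun w => (mem_S w).1,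
        fun i w hw => (mem_S w).1 (pos_of_rest w (hTpos i w hw))⟩, fun w w' => ?_⟩
    simp only [Fin.sum_univ_succ, Fin.cons_zero, Fin.cons_succ]
    rw [← hsum w w']
    by_cases hw : w ∈ S <;> by_cases hw' : w' ∈ S
    · simp [rest, hw, hw', min_sub_sub_right]
    · simp [rest, hw, hw', eq_zero w' hw', hφ w, hmin w hw]
    · simp [rest, hw, hw', eq_zero w hw, hφ w', hmin w' hw']
    · simp [rest, hw, hw', eq_zero]

variable [Fintype W]

/-- The total weight of the edges leaving `S` in the graph with weight matrix `k`. -/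
def cutWeight (k : Matrix W W ℝ) (S : Finset W) : ℝ :=
  ∑ w, ∑ w', if w ∈ S ∧ w' ∉ S then k w w' else 0

theorem mul_sum_le_sum_mul_posPart (k : Matrix W W ℝ) (c : ℝ) (φ : W → ℝ) (hφ : ∀ w, 0 ≤ φ w)
    (h : ∀ S : Finset W, (∀ w ∈ S, 0 < φ w) → c * #S ≤ cutWeight k S) :
    c * ∑ w, φ w ≤ ∑ w, ∑ w', k w w' * max (φ w - φ w') 0 := by
  obtain ⟨n, S, m, hm, -, hS, hmin⟩ := exists_layers φ hφ
  have hφS : ∀ w, φ w = ∑ i, if w ∈ S i then m i else 0 := fun w => by simpa using hmin w w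
  have hdiff : ∀ w w', max (φ w - φ w') 0 = ∑ i, if w ∈ S i ∧ w' ∉ S i then m i else 0 := by
    intro w w'
    rw [← sub_self (φ w), max_sub_sub_left, min_comm, hmin, hφS, ← sum_sub_distrib]
    refine sum_congr rfl fun i _ => ?_
    by_cases hw : w ∈ S i <;> by_cases hw' : w' ∈ S i <;> simp [hw, hw']
  calc c * ∑ w, φ w = ∑ i, m i * (c * #(S i)) := by
        simp only [hφS]
        rw [sum_comm, mul_sum]
        refine sum_congr rfl fun i _ => ?_
        simp only [sum_ite_mem, univ_inter, sum_const, nsmul_eq_mul]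
        ring
    _ ≤ ∑ i, m i * cutWeight k (S i) :=
        sum_le_sum fun i _ => mul_le_mul_of_nonneg_left (h _ (hS i)) (hm i).le
    _ = ∑ w, ∑ w', k w w' * max (φ w - φ w') 0 := by
        simp only [hdiff, cutWeight, mul_sum, mul_ite, mul_zero]
        refine sum_comm.trans (sum_congr rfl fun w _ => sum_comm.trans ?_)
        simp only [mul_comm]

theorem mul_sum_sq_le_of_cells {ι : Type*} [DecidableEq ι] (k : Matrix W W ℝ) (c : ℝ)
    (r : W → ℝ) (cell : W → ι)
    (h : ∀ (i : ι) (S : Finset W), (∀ w ∈ S, r w ≠ 0 ∧ cell w = i) → c * #S ≤ cutWeight k S) :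
    c * ∑ w, r w ^ 2 ≤
      ∑ w, ∑ w', k w w' * if cell w = cell w' then max (r w ^ 2 - r w' ^ 2) 0 else r w ^ 2 := by
  let φ : ι → W → ℝ := fun i w => if cell w = i then r w ^ 2 else 0
  have hφ : ∀ i w, 0 ≤ φ i w := fun i w => by dsimp only [φ]; split_ifs <;> positivity
  have hcoarea : ∀ i, c * ∑ w, φ i w ≤ ∑ w, ∑ w', k w w' * max (φ i w - φ i w') 0 := fun i =>
    mul_sum_le_sum_mul_posPart k c (φ i) (hφ i) fun S hS => h i S fun w hw => by
      have hpos := hS w hw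
      by_cases hi : cell w = i
      · exact ⟨fun h₀ => by simp [φ, h₀] at hpos, hi⟩
      · simp [φ, hi] at hpos
  have sum_cells : ∀ w, ∀ f : ι → ℝ, (∀ i ≠ cell w, f i = 0) →
      ∑ i ∈ univ.image cell, f i = f (cell w) := fun w f hf =>
    sum_eq_single_of_mem _ (mem_image_of_mem _ (mem_univ w)) fun i _ => hf i
  calc c * ∑ w, r w ^ 2 = ∑ i ∈ univ.image cell, c * ∑ w, φ i w := by
        rw [← mul_sum, sum_comm]
        congr 1
        refine sum_congr rfl fun w _ => ?_
        rw [sum_cells w _ fun i hi => if_neg hi.symm]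
        simp
    _ ≤ ∑ i ∈ univ.image cell, ∑ w, ∑ w', k w w' * max (φ i w - φ i w') 0 :=
        sum_le_sum fun i _ => hcoarea i
    _ = _ := by
        rw [sum_comm]
        refine sum_congr rfl fun w _ => ?_
        rw [sum_comm]
        refine sum_congr rfl fun w' _ => ?_
        rw [← mul_sum, sum_cells w]
        · by_cases hcell : cell w = cell w'
          · simp [φ, hcell]
          · simp [φ, hcell, Ne.symm hcell, sq_nonneg]
        · intro i hi
          simp [φ, hi.symm, hφ i w']

theorem exists_layer_sum_le (R b : W → W → ℝ) {φ : W → ℝ} (hφ : ∀ w, 0 ≤ φ w) (hφ₀ : φ ≠ 0)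
    (h : ∑ w, ∑ w', max (φ w) (φ w') * R w w' ≤ ∑ w, ∑ w', min (φ w) (φ w') * b w w') :
    ∃ S : Finset W, S.Nonempty ∧ (∀ w ∈ S, 0 < φ w) ∧
      ∑ w, ∑ w', (if w ∈ S ∨ w' ∈ S then R w w' else 0) ≤
        ∑ w, ∑ w', if w ∈ S ∧ w' ∈ S then b w w' else 0 := by
  obtain ⟨n, S, m, hm, hS₀, hS, hmin⟩ := exists_layers φ hφ
  have hφS : ∀ w, φ w = ∑ i, if w ∈ S i then m i else 0 := fun w => by simpa using hmin w w
  have hmax : ∀ w w', max (φ w) (φ w') = ∑ i, if w ∈ S i ∨ w' ∈ S i then m i else 0 := by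
    intro w w'
    rw [eq_sub_of_add_eq' (min_add_max (φ w) (φ w')), hmin, hφS w, hφS w', ← sum_add_distrib,
      ← sum_sub_distrib]
    refine sum_congr rfl fun i _ => ?_
    by_cases hw : w ∈ S i <;> by_cases hw' : w' ∈ S i <;> simp [hw, hw']
  have sum_layers : ∀ (P : Finset W → W → W → Prop) [∀ S w w', Decidable (P S w w')]
      (f : W → W → ℝ), ∑ w, ∑ w', (∑ i, if P (S i) w w' then m i else 0) * f w w' =
        ∑ i, m i * ∑ w, ∑ w', if P (S i) w w' then f w w' else 0 := by
    intro P _ f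
    simp only [sum_mul, mul_sum, mul_ite, ite_mul, mul_zero, zero_mul]
    exact (sum_congr rfl fun w _ => sum_comm).trans sum_comm
  simp only [hmax, hmin] at h
  rw [sum_layers fun S w w' => w ∈ S ∨ w' ∈ S, sum_layers fun S w w' => w ∈ S ∧ w' ∈ S] at h
  have hn : (univ : Finset (Fin n)).Nonempty := by
    by_contra! hempty
    exact hφ₀ (funext fun w => by rw [hφS, hempty, sum_empty, Pi.zero_apply])
  obtain ⟨i, -, hi⟩ := exists_le_of_sum_le hn h
  exact ⟨S i, hS₀ i, hS i, le_of_mul_le_mul_left hi (hm i)⟩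

end Layers

section Breakpoints

variable {W : Type*} [Fintype W]

theorem exists_order_statistic (u : W → ℝ) {k : ℕ} (hk : 0 < k) (hkW : k ≤ Fintype.card W) :
    ∃ τ, #{w | u w < τ} < k ∧ k ≤ #{w | u w ≤ τ} := by
  have : Nonempty W := Fintype.card_pos_iff.1 (hk.trans_le hkW)
  obtain ⟨top, htop⟩ := Finite.exists_max u
  obtain ⟨w₀, hw₀, hmin⟩ := exists_min_image {w | k ≤ #{w' | u w' ≤ u w}} u
    ⟨top, by simpa [filter_true_of_mem fun w _ => htop w] using hkW⟩
  refine ⟨u w₀, ?_, by simpa using hw₀⟩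
  by_contra! hge
  obtain ⟨w₁, hw₁, hmax⟩ := exists_max_image {w | u w < u w₀} u (card_pos.1 (hk.trans_le hge))
  have hle : u w₀ ≤ u w₁ := by
    refine hmin w₁ (mem_filter.2 ⟨mem_univ _, hge.trans (card_le_card fun w hw => ?_)⟩)
    exact mem_filter.2 ⟨mem_univ _, hmax w hw⟩
  exact hle.not_gt (mem_filter.1 hw₁).2

theorem exists_breakpoints (u : W → ℝ) {m : ℕ} (hm : 0 < m) :
    ∃ T : Finset ℝ, #T ≤ Fintype.card W / m ∧
      ∀ S : Finset W, (∀ τ ∈ T, (∀ w ∈ S, u w < τ) ∨ ∀ w ∈ S, τ < u w) → #S < m := by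
  set n := Fintype.card W
  have hstat : ∀ j ∈ Icc 1 (n / m), ∃ τ, #{w | u w < τ} < j * m ∧ j * m ≤ #{w | u w ≤ τ} :=
    fun j hj => exists_order_statistic u (Nat.mul_pos (mem_Icc.1 hj).1 hm)
      ((Nat.le_div_iff_mul_le hm).1 (mem_Icc.1 hj).2)
  choose! τ hlt hle using hstat
  refine ⟨(Icc 1 (n / m)).image τ, card_image_le.trans (by simp), fun S hS => ?_⟩
  by_contra! hmS
  classical
  have hS₀ : S.Nonempty := card_pos.1 (hm.trans_le hmS)
  obtain ⟨lo, hlo, hmin⟩ := S.exists_min_image u hS₀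
  obtain ⟨hi, hhi, hmax⟩ := S.exists_max_image u hS₀
  set p := #{w | u w < u lo}
  have hp : p + #S ≤ #{w | u w ≤ u hi} := by
    rw [← card_union_of_disjoint]
    · refine card_le_card fun w hw => mem_filter.2 ⟨mem_univ _, ?_⟩
      rcases mem_union.1 hw with hw | hw
      · exact (mem_filter.1 hw).2.le.trans (hmin hi hhi)
      · exact hmax w hw
    · exact disjoint_left.2 fun w hw hwS => (hmin w hwS).not_gt (mem_filter.1 hw).2
  -- Some multiple of `m` lies in `(p, p + m]`, so the order statistic of that rank lies between
  -- `u lo` and `u hi`.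
  set j := p / m + 1
  have hpj : p < j * m := Nat.lt_mul_of_div_lt (Nat.lt_succ_self _) hm
  have hjp : j * m ≤ p + m := by
    rw [Nat.add_mul, one_mul]; exact Nat.add_le_add_right (Nat.div_mul_le_self p m) m
  have hj : j ∈ Icc 1 (n / m) := mem_Icc.2 ⟨Nat.le_add_left _ _, (Nat.le_div_iff_mul_le hm).2
    (hjp.trans <| (Nat.add_le_add_left hmS p).trans <| hp.trans (card_le_univ _))⟩
  rcases hS (τ j) (mem_image_of_mem τ hj) with hbelow | habove
  · have : #{w | u w ≤ u hi} ≤ #{w | u w < τ j} :=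
      card_le_card (monotone_filter_right _ fun w _ hw => lt_of_le_of_lt hw (hbelow hi hhi))
    have := hlt j hj
    omega
  · have : #{w | u w ≤ τ j} ≤ p :=
      card_le_card (monotone_filter_right _ fun w _ hw => lt_of_le_of_lt hw (habove lo hlo))
    have := hle j hj
    omega

theorem exists_breakpoints_of_fraction (u : W → ℝ) {ε : ℝ} (hε : 0 < ε) :
    ∃ T : Finset ℝ, (#T : ℝ) ≤ 1 / ε ∧
      ∀ S : Finset W, (∀ τ ∈ T, (∀ w ∈ S, u w < τ) ∨ ∀ w ∈ S, τ < u w) →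
        (#S : ℝ) ≤ ε * Fintype.card W := by
  set n : ℝ := ((Fintype.card W : ℕ) : ℝ)
  obtain ⟨T, hT, hcell⟩ := exists_breakpoints u (Nat.succ_pos ⌊ε * n⌋₊)
  refine ⟨T, ?_, fun S hS => ?_⟩
  · calc (#T : ℝ) ≤ n / ((⌊ε * n⌋₊ + 1 : ℕ) : ℝ) := (Nat.cast_le.2 hT).trans Nat.cast_div_le
      _ ≤ 1 / ε := by
        rw [div_le_div_iff₀ (by positivity) hε, one_mul, mul_comm]
        exact_mod_cast (Nat.lt_floor_add_one (ε * n)).le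
  · exact (Nat.cast_le.2 (Nat.lt_succ_iff.1 (hcell S hS))).trans (Nat.floor_le (by positivity))

end Breakpoints

section Distance

open Metric MeasureTheory

theorem abs_integral_infDist_sub_le (T : Set ℝ) (a b : ℝ) :
    |(∫ s in (0 : ℝ)..a, infDist s T) - ∫ s in (0 : ℝ)..b, infDist s T| ≤
      |a - b| * (infDist a T + |a - b|) := by
  have hcont : Continuous fun s : ℝ => infDist s T := continuous_infDist_pt T
  rw [intervalIntegral.integral_interval_sub_left (hcont.intervalIntegrable _ _)
    (hcont.intervalIntegrable _ _), mul_comm]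
  refine intervalIntegral.norm_integral_le_of_norm_le_const (f := (infDist · T)) fun s hs => ?_
  rw [Real.norm_of_nonneg infDist_nonneg]
  refine (infDist_le_infDist_add_dist (y := a)).trans (add_le_add_right ?_ _)
  simpa [Real.dist_eq, abs_sub_comm] using
    Set.abs_sub_right_of_mem_uIcc (Set.uIoc_subset_uIcc hs)

theorem integral_infDist_le_sq_div_two {T : Set ℝ} (h₀ : (0 : ℝ) ∈ T) {t : ℝ} (ht : 0 ≤ t) :
    ∫ s in (0 : ℝ)..t, infDist s T ≤ t ^ 2 / 2 := by
  have hmono : ∫ s in (0 : ℝ)..t, infDist s T ≤ ∫ s in (0 : ℝ)..t, s :=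
    intervalIntegral.integral_mono_on ht ((continuous_infDist_pt T).intervalIntegrable _ _)
      (continuous_id.intervalIntegrable _ _) fun s hs => by
        simpa [Real.dist_eq, abs_of_nonneg hs.1] using infDist_le_dist_of_mem (x := s) h₀
  simpa using hmono

theorem sq_div_card_le_integral_infDist {T : Finset ℝ} (hT : T.Nonempty) {t : ℝ} (ht : 0 ≤ t) :
    t ^ 2 / (8 * #T) ≤ ∫ s in (0 : ℝ)..t, infDist s (T : Set ℝ) := by
  set h : ℝ := t / (4 * #T) with hh
  have h_nonneg : 0 ≤ h := by positivity
  set near : Set ℝ := ⋃ τ ∈ T, ball τ h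
  have near_meas : MeasurableSet near := T.measurableSet_biUnion fun _ _ => measurableSet_ball
  have volume_near : volume.real near ≤ t / 2 := calc
    volume.real near ≤ ∑ τ ∈ T, volume.real (ball τ h) := measureReal_biUnion_finset_le _ _
    _ = t / 2 := by
      simp only [Real.volume_real_ball h_nonneg, sum_const, nsmul_eq_mul]
      rw [hh]; field_simp; ring
  have near_ne_top : volume near ≠ ⊤ :=
    (measure_biUnion_lt_top T.finite_toSet fun _ _ => measure_ball_lt_top).ne
  have volume_far : t / 2 ≤ volume.real (Set.Ioc 0 t \ near) := by
    have := le_measureReal_sdiff (s₁ := Set.Ioc 0 t) near_ne_top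
    rw [Real.volume_real_Ioc_of_le ht] at this
    linarith
  have le_infDist : ∀ s ∈ Set.Ioc 0 t \ near, h ≤ infDist s T := by
    intro s hs
    by_contra! hlt
    obtain ⟨τ, hτ, hdist⟩ := (infDist_lt_iff (by simpa using hT)).1 hlt
    exact hs.2 (Set.mem_biUnion hτ (mem_ball.2 hdist))
  have hint : IntegrableOn (fun s => infDist s (T : Set ℝ)) (Set.Ioc 0 t) :=
    (continuous_infDist_pt _).integrableOn_Ioc
  calc t ^ 2 / (8 * #T) = h * (t / 2) := by rw [hh]; field_simp; ring
    _ ≤ h * volume.real (Set.Ioc 0 t \ near) := by gcongr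
    _ ≤ ∫ s in Set.Ioc 0 t \ near, infDist s (T : Set ℝ) :=
      setIntegral_ge_of_const_le_real (measurableSet_Ioc.diff near_meas)
        (measure_ne_top_of_subset Set.sdiff_subset (by simp)) le_infDist
        (hint.mono_set Set.sdiff_subset)
    _ ≤ ∫ s in Set.Ioc 0 t, infDist s (T : Set ℝ) :=
      setIntegral_mono_set hint (ae_of_all _ fun _ => infDist_nonneg)
        Set.sdiff_subset.eventuallyLE
    _ = ∫ s in (0 : ℝ)..t, infDist s (T : Set ℝ) := (intervalIntegral.integral_of_le ht).symm

end Distance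

section Expansion

open Metric

variable {W : Type*} [Fintype W] [DecidableEq W] {k : Matrix W W ℝ} {d ε γ : ℝ}

/-- Small-set expansion of a weighted graph, given by its symmetric weight matrix `k`, all of
whose vertices have degree `d`. -/
structure IsWeightedSmallSetExpander (k : Matrix W W ℝ) (d ε γ : ℝ) : Prop where
  nonneg : ∀ w w', 0 ≤ k w w'
  symm : ∀ w w', k w w' = k w' w
  sum_eq : ∀ w, ∑ w', k w w' = d
  le_cutWeight : ∀ S : Finset W, (#S : ℝ) ≤ ε * Fintype.card W → γ * d * #S ≤ cutWeight k S

/-- The energy of `u` in the graph with weight matrix `k`, every pair being counted twice. -/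
def energy (k : Matrix W W ℝ) (u : W → ℝ) : ℝ :=
  ∑ w, ∑ w', k w w' * (u w - u w') ^ 2

namespace IsWeightedSmallSetExpander

theorem sum_sum_mul_left (hk : IsWeightedSmallSetExpander k d ε γ) (f : W → ℝ) :
    ∑ w, ∑ w', k w w' * f w = d * ∑ w, f w := by
  simp only [← sum_mul, hk.sum_eq, mul_sum]

theorem sum_sum_mul_right (hk : IsWeightedSmallSetExpander k d ε γ) (f : W → ℝ) :
    ∑ w, ∑ w', k w w' * f w' = d * ∑ w, f w := by
  rw [sum_comm, ← hk.sum_sum_mul_left]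
  simp only [hk.symm]

end IsWeightedSmallSetExpander

theorem infDist_add_infDist_le {T : Set ℝ} {a b τ : ℝ} (hτ : τ ∈ T) (ha : a ≤ τ) (hb : τ ≤ b) :
    infDist a T + infDist b T ≤ |a - b| := by
  have hda := infDist_le_dist_of_mem (x := a) hτ
  have hdb := infDist_le_dist_of_mem (x := b) hτ
  rw [Real.dist_eq, abs_of_nonpos (by linarith)] at hda
  rw [Real.dist_eq, abs_of_nonneg (by linarith)] at hdb
  rw [abs_of_nonpos (by linarith)]
  linarith

theorem sq_infDist_change_le (T : Finset ℝ) (a b : ℝ) :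
    (if T.filter (· < a) = T.filter (· < b) then
      max (infDist a (T : Set ℝ) ^ 2 - infDist b (T : Set ℝ) ^ 2) 0 else infDist a (T : Set ℝ) ^ 2)
      ≤ |a - b| * (infDist a (T : Set ℝ) + infDist b (T : Set ℝ)) := by
  have ha : 0 ≤ infDist a (T : Set ℝ) := infDist_nonneg
  have hb : 0 ≤ infDist b (T : Set ℝ) := infDist_nonneg
  split_ifs with hcell
  · have hlip : infDist a (T : Set ℝ) - infDist b (T : Set ℝ) ≤ |a - b| := by
      linarith [Real.dist_eq a b, infDist_le_infDist_add_dist (s := (T : Set ℝ)) (x := a) (y := b)]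
    refine max_le ?_ (by positivity)
    rw [sq_sub_sq, mul_comm]
    gcongr
  · have hsep : infDist a (T : Set ℝ) + infDist b (T : Set ℝ) ≤ |a - b| := by
      by_contra! hlt
      refine hcell (filter_congr fun τ hτ => ⟨fun hτa => ?_, fun hτb => ?_⟩) <;> by_contra! hge
      · rw [add_comm, abs_sub_comm] at hlt
        exact hlt.not_ge (infDist_add_infDist_le hτ hge hτa.le)
      · exact hlt.not_ge (infDist_add_infDist_le hτ hge hτb.le)
    nlinarith

theorem IsWeightedSmallSetExpander.sum_sq_infDist_le (hk : IsWeightedSmallSetExpander k d ε γ)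
    (hγ : 0 < γ) (u : W → ℝ) (T : Finset ℝ)
    (hT : ∀ S : Finset W, (∀ τ ∈ T, (∀ w ∈ S, u w < τ) ∨ ∀ w ∈ S, τ < u w) →
      (#S : ℝ) ≤ ε * Fintype.card W) :
    γ ^ 2 * (d * ∑ w, infDist (u w) (T : Set ℝ) ^ 2) ≤ 4 * energy k u := by
  set r : W → ℝ := fun w => infDist (u w) (T : Set ℝ)
  have hcells := mul_sum_sq_le_of_cells k (γ * d) r (fun w => T.filter (· < u w)) fun T₀ S hS =>
    hk.le_cutWeight S <| hT S fun τ hτ => by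
      by_cases hτ₀ : τ ∈ T₀
      · exact .inr fun w hw => (mem_filter.1 ((hS w hw).2 ▸ hτ₀ : τ ∈ T.filter (· < u w))).2
      · refine .inl fun w hw => lt_of_le_of_ne (not_lt.1 fun hlt => hτ₀ ?_) fun heq => ?_
        · exact (hS w hw).2 ▸ mem_filter.2 ⟨hτ, hlt⟩
        · exact (hS w hw).1 (infDist_zero_of_mem (by simpa [heq] using hτ))
  have amgm : ∀ w w', |u w - u w'| * (r w + r w') ≤
      2 / γ * (u w - u w') ^ 2 + γ / 4 * r w ^ 2 + γ / 4 * r w' ^ 2 := fun w w' => by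
    rw [← sq_abs (u w - u w'), ← sub_nonneg]
    refine (show 0 ≤ 1 / γ * ((|u w - u w'| - γ / 2 * r w) ^ 2 +
      (|u w - u w'| - γ / 2 * r w') ^ 2) by positivity).trans_eq ?_
    field_simp; ring
  have hle : γ * d * ∑ w, r w ^ 2 ≤ 2 / γ * energy k u + γ / 2 * (d * ∑ w, r w ^ 2) := calc
    γ * d * ∑ w, r w ^ 2 ≤ _ := hcells
    _ ≤ ∑ w, ∑ w', k w w' *
        (2 / γ * (u w - u w') ^ 2 + γ / 4 * r w ^ 2 + γ / 4 * r w' ^ 2) := by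
      gcongr with w _ w' _
      · exact hk.nonneg w w'
      · exact (sq_infDist_change_le T _ _).trans (amgm w w')
    _ = 2 / γ * energy k u + γ / 4 * ∑ w, ∑ w', k w w' * r w ^ 2 +
        γ / 4 * ∑ w, ∑ w', k w w' * r w' ^ 2 := by
      simp only [energy, mul_add, sum_add_distrib, mul_sum, mul_left_comm]
    _ = _ := by rw [hk.sum_sum_mul_left (r · ^ 2), hk.sum_sum_mul_right (r · ^ 2)]; ring
  have := mul_le_mul_of_nonneg_left hle hγ.le
  have hcancel : γ * (2 / γ * energy k u) = 2 * energy k u := by field_simp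
  nlinarith

theorem IsWeightedSmallSetExpander.sum_abs_integral_infDist_sub_le
    (hk : IsWeightedSmallSetExpander k d ε γ) (hγ : 0 < γ) (hγ₁ : γ ≤ 1) (u : W → ℝ) (T : Set ℝ)
    (hT : γ ^ 2 * (d * ∑ w, infDist (u w) T ^ 2) ≤ 4 * energy k u) :
    ∑ w, ∑ w', k w w' * |(∫ s in (0 : ℝ)..u w, infDist s T) - ∫ s in (0 : ℝ)..u w', infDist s T| ≤
      4 / γ * energy k u := by
  have hE : 0 ≤ energy k u :=
    sum_nonneg fun w _ => sum_nonneg fun w' _ => mul_nonneg (hk.nonneg w w') (sq_nonneg _)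
  have hpair : ∀ w w', |(∫ s in (0 : ℝ)..u w, infDist s T) - ∫ s in (0 : ℝ)..u w', infDist s T| ≤
      (1 + 1 / (2 * γ)) * (u w - u w') ^ 2 + γ / 2 * infDist (u w) T ^ 2 := fun w w' => by
    refine (abs_integral_infDist_sub_le _ _ _).trans ?_
    rw [← sq_abs (u w - u w'), ← sub_nonneg]
    refine (show 0 ≤ 1 / (2 * γ) * (|u w - u w'| - γ * infDist (u w) T) ^ 2 by
      positivity).trans_eq ?_
    field_simp; ring
  calc _ ≤ ∑ w, ∑ w', k w w' *
        ((1 + 1 / (2 * γ)) * (u w - u w') ^ 2 + γ / 2 * infDist (u w) T ^ 2) := by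
        gcongr with w _ w' _
        · exact hk.nonneg w w'
        · exact hpair w w'
    _ = (1 + 1 / (2 * γ)) * energy k u + γ / 2 * (d * ∑ w, infDist (u w) T ^ 2) := by
        rw [← hk.sum_sum_mul_left fun w => infDist (u w) T ^ 2]
        simp only [energy, mul_add, sum_add_distrib, mul_sum, mul_left_comm]
    _ ≤ 4 / γ * energy k u := by
        rw [div_mul_eq_mul_div 4, le_div_iff₀ hγ]
        have hcancel : 1 / (2 * γ) * energy k u * γ = energy k u / 2 := by field_simp
        nlinarith

theorem IsWeightedSmallSetExpander.exists_profile (hk : IsWeightedSmallSetExpander k d ε γ)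
    (hε : 0 < ε) (hε₁ : ε ≤ 1) (hγ : 0 < γ) (hγ₁ : γ ≤ 1) (u : W → ℝ) :
    ∃ ψ : ℝ → ℝ, (∀ t, 0 ≤ t → ε / 16 * t ^ 2 ≤ ψ t ∧ ψ t ≤ t ^ 2 / 2) ∧
      ∑ w, ∑ w', k w w' * |ψ (u w) - ψ (u w')| ≤ 4 / γ * energy k u := by
  obtain ⟨T', hT', hcell⟩ := exists_breakpoints_of_fraction u hε
  set T := insert 0 T'
  have hT₀ : T.Nonempty := insert_nonempty 0 T'
  have hcard : (#T : ℝ) ≤ 2 / ε := calc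
    (#T : ℝ) ≤ #T' + 1 := by exact_mod_cast card_insert_le 0 T'
    _ ≤ 1 / ε + 1 / ε := add_le_add hT' (one_le_one_div hε hε₁)
    _ = 2 / ε := by ring
  refine ⟨fun t => ∫ s in (0 : ℝ)..t, infDist s (T : Set ℝ), fun t ht => ⟨?_, ?_⟩, ?_⟩
  · refine le_trans ?_ (sq_div_card_le_integral_infDist hT₀ ht)
    rw [le_div_iff₀ hε] at hcard
    rw [le_div_iff₀ (by simpa using hT₀.card_pos)]
    nlinarith [sq_nonneg t]
  · exact integral_infDist_le_sq_div_two (by simp [T]) ht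
  · exact hk.sum_abs_integral_infDist_sub_le hγ hγ₁ u T <| hk.sum_sq_infDist_le hγ u T
      fun S hS => hcell S fun τ hτ => hS τ (mem_insert_of_mem hτ)

end Expansion

section Labellings

variable {X Y A B Ω : Type*}

/-- The total amount of labels that the fractional labelling `q` puts on `x`. -/
def labelMass [Fintype A] (q : X → A → ℝ) (x : X) : ℝ :=
  ∑ a, q x a

/-- A fractional labelling: a randomized strategy for Alice that may also abstain. -/
structure IsFractionalLabelling [Fintype A] (q : X → A → ℝ) : Prop where
  nonneg : ∀ x a, 0 ≤ q x a
  labelMass_le : ∀ x, labelMass q x ≤ 1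

/-- A vector labelling: at every vertex, the vector `(labelMass (F ω) x)_ω` lies in the
Euclidean unit ball. -/
structure IsVectorLabelling [Fintype A] [Fintype Ω] (F : Ω → X → A → ℝ) : Prop where
  nonneg : ∀ ω x a, 0 ≤ F ω x a
  sum_sq_le : ∀ x, ∑ ω, labelMass (F ω) x ^ 2 ≤ 1

/-- The payoff kernel of a projection game with edge weights `e`: given the answer of Alice, the
total payoff over the answers of Bob is at most the weight of the edge. -/
structure IsProjectionKernel [Fintype B] (K : X → A → Y → B → ℝ) (e : Matrix X Y ℝ) : Prop where
  nonneg : ∀ x a y b, 0 ≤ K x a y b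
  sum_le : ∀ x a y, ∑ b, K x a y b ≤ e x y

/-- The payoff that the labels of `q` at `x` bring to the answer `b` to `y`. -/
def answerWeight [Fintype A] (K : X → A → Y → B → ℝ) (q : X → A → ℝ) (x : X) (y : Y) (b : B) : ℝ :=
  ∑ a, K x a y b * q x a

/-- The operator of the game with payoff kernel `K`, applied to `q`. -/
def gameOp [Fintype X] [Fintype A] (K : X → A → Y → B → ℝ) (q : X → A → ℝ) (y : Y) (b : B) : ℝ :=
  ∑ x, answerWeight K q x y b

/-- The collision value of `q`: Alice is asked two questions with a common neighbour `y`, answers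
both independently according to `q`, and wins if her two answers project to the same answer
to `y`. -/
def collisionValue [Fintype X] [Fintype Y] [Fintype A] [Fintype B] (K : X → A → Y → B → ℝ)
    (q : X → A → ℝ) : ℝ :=
  ∑ y, ∑ b, gameOp K q y b ^ 2

/-- The contribution of the pair of questions `x`, `x'` to the collision value. -/
def agreement [Fintype Y] [Fintype A] [Fintype B] (K : X → A → Y → B → ℝ) (q : X → A → ℝ)
    (x x' : X) : ℝ :=
  ∑ y, ∑ b, answerWeight K q x y b * answerWeight K q x' y b

variable [Fintype A] {K : X → A → Y → B → ℝ} {e : Matrix X Y ℝ} {q q' : X → A → ℝ} {x x' : X}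

theorem labelMass_nonneg (hq : ∀ x a, 0 ≤ q x a) (x : X) : 0 ≤ labelMass q x :=
  sum_nonneg fun a _ => hq x a

theorem IsFractionalLabelling.piecewise [DecidableEq X] {p q : X → A → ℝ}
    (hp : IsFractionalLabelling p) (hq : IsFractionalLabelling q) (S : Finset X) :
    IsFractionalLabelling (S.piecewise p q) where
  nonneg x a := by by_cases hx : x ∈ S <;> simp [hx, hp.nonneg, hq.nonneg]
  labelMass_le x := by
    have := hp.labelMass_le x
    have := hq.labelMass_le x
    by_cases hx : x ∈ S <;> simpa [labelMass, hx]

theorem answerWeight_congr (h : q x = q' x) (y : Y) (b : B) :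
    answerWeight K q x y b = answerWeight K q' x y b := by
  simp only [answerWeight, h]

theorem answerWeight_div (F : X → A → ℝ) (g : X → ℝ) (x : X) (y : Y) (b : B) :
    answerWeight K (fun x a => F x a / g x) x y b = answerWeight K F x y b / g x := by
  simp only [answerWeight, sum_div, mul_div_assoc]

variable [Fintype B]

theorem IsProjectionKernel.answerWeight_nonneg (hK : IsProjectionKernel K e)
    (hq : ∀ x a, 0 ≤ q x a) (x : X) (y : Y) (b : B) : 0 ≤ answerWeight K q x y b :=
  sum_nonneg fun a _ => mul_nonneg (hK.nonneg x a y b) (hq x a)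

theorem IsProjectionKernel.sum_answerWeight_le (hK : IsProjectionKernel K e)
    (hq : ∀ x a, 0 ≤ q x a) (x : X) (y : Y) :
    ∑ b, answerWeight K q x y b ≤ e x y * labelMass q x := by
  simp only [answerWeight, labelMass]
  rw [sum_comm, mul_sum]
  gcongr with a _
  rw [← sum_mul]
  exact mul_le_mul_of_nonneg_right (hK.sum_le x a y) (hq x a)

variable [Fintype Y]

theorem agreement_congr (h : q x = q' x) (h' : q x' = q' x') :
    agreement K q x x' = agreement K q' x x' := by
  simp only [agreement, answerWeight_congr h, answerWeight_congr h']

theorem agreement_div (F : X → A → ℝ) (g : X → ℝ) (x x' : X) :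
    agreement K (fun x a => F x a / g x) x x' = agreement K F x x' / (g x * g x') := by
  simp only [agreement, answerWeight_div, div_mul_div_comm, sum_div]

theorem agreement_eq_zero_left (h : q x = 0) : agreement K q x x' = 0 := by
  simp [agreement, answerWeight, h]

theorem agreement_eq_zero_right (h : q x' = 0) : agreement K q x x' = 0 := by
  simp [agreement, answerWeight, h]

theorem IsProjectionKernel.agreement_nonneg (hK : IsProjectionKernel K e)
    (hq : ∀ x a, 0 ≤ q x a) (x x' : X) : 0 ≤ agreement K q x x' :=
  sum_nonneg fun y _ => sum_nonneg fun b _ =>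
    mul_nonneg (hK.answerWeight_nonneg hq x y b) (hK.answerWeight_nonneg hq x' y b)

theorem IsProjectionKernel.agreement_le (hK : IsProjectionKernel K e)
    (hq : ∀ x a, 0 ≤ q x a) (x x' : X) :
    agreement K q x x' ≤ (e * eᵀ) x x' * (labelMass q x * labelMass q x') := by
  have hw := hK.answerWeight_nonneg hq
  simp only [mul_apply, transpose_apply, sum_mul]
  refine sum_le_sum fun y _ => ?_
  calc ∑ b, answerWeight K q x y b * answerWeight K q x' y b
      ≤ ∑ b, answerWeight K q x y b * ∑ b', answerWeight K q x' y b' := by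
        gcongr with b _
        · exact hw x y b
        · exact single_le_sum (fun b _ => hw x' y b) (mem_univ b)
    _ = (∑ b, answerWeight K q x y b) * ∑ b, answerWeight K q x' y b := by rw [sum_mul]
    _ ≤ (e x y * labelMass q x) * (e x' y * labelMass q x') :=
        mul_le_mul (hK.sum_answerWeight_le hq x y) (hK.sum_answerWeight_le hq x' y)
          (sum_nonneg fun b _ => hw x' y b)
          ((sum_nonneg fun b _ => hw x y b).trans (hK.sum_answerWeight_le hq x y))
    _ = e x y * e x' y * (labelMass q x * labelMass q x') := by ring

variable [Fintype X]

theorem collisionValue_eq_sum_agreement (K : X → A → Y → B → ℝ) (q : X → A → ℝ) :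
    collisionValue K q = ∑ x, ∑ x', agreement K q x x' := by
  simp only [collisionValue, gameOp, agreement, sq, sum_mul_sum]
  have sum_rotate : ∀ f : B → X → X → ℝ, ∑ b, ∑ x, ∑ x', f b x x' = ∑ x, ∑ x', ∑ b, f b x x' :=
    fun f => sum_comm.trans (sum_congr rfl fun x _ => sum_comm)
  simp only [sum_rotate]
  exact sum_comm.trans (sum_congr rfl fun x _ => sum_comm)

/-- A biregular weighted bipartite graph, all of whose vertices have degree `d`. -/
structure IsBiregular (e : Matrix X Y ℝ) (d : ℝ) : Prop where
  nonneg : ∀ x y, 0 ≤ e x y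
  sum_row : ∀ x, ∑ y, e x y = d
  sum_col : ∀ y, ∑ x, e x y = d

theorem IsBiregular.codegree_nonneg {d : ℝ} (he : IsBiregular e d) (x x' : X) :
    0 ≤ (e * eᵀ) x x' :=
  sum_nonneg fun y _ => mul_nonneg (he.nonneg x y) (he.nonneg x' y)

theorem IsBiregular.sum_codegree {d : ℝ} (he : IsBiregular e d) (x : X) :
    ∑ x', (e * eᵀ) x x' = d ^ 2 := by
  simp only [mul_apply, transpose_apply]
  rw [sum_comm]
  simp only [← mul_sum, he.sum_col, ← sum_mul, he.sum_row, sq]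

theorem sum_codegree_mul_mul (e : Matrix X Y ℝ) (f : X → ℝ) :
    ∑ x, ∑ x', (e * eᵀ) x x' * (f x * f x') = ∑ y, (f ᵥ* e) y ^ 2 := by
  have h : ∑ x, ∑ x', (e * eᵀ) x x' * (f x * f x') = f ⬝ᵥ (e * eᵀ) *ᵥ f := by
    simp only [dotProduct, mulVec, mul_sum]
    exact sum_congr rfl fun x _ => sum_congr rfl fun x' _ => by ring
  rw [h, ← mulVec_mulVec, dotProduct_mulVec, mulVec_transpose]
  simp only [dotProduct, sq]

end Labellings

section CorrelatedSampling

variable {X Y A B Ω : Type*} [Fintype X] [Fintype Y] [Fintype A] [Fintype B] [Fintype Ω]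
  {K : X → A → Y → B → ℝ} {e : Matrix X Y ℝ}

/-- Correlated sampling of `ω` at two vertices with sampling weights `φ` and `φ'` (the first
point of a common Poisson process under the graph of the weight): a lower bound for the
expectation of `c` on the event that the two samples coincide. -/
noncomputable def samplingRatio (φ φ' c : Ω → ℝ) : ℝ :=
  (∑ ω, min (φ ω) (φ' ω) * c ω) / ∑ ω, max (φ ω) (φ' ω)

theorem samplingRatio_eq_zero_left {φ φ' c : Ω → ℝ} (h : ∀ ω, φ ω = 0) (hφ' : ∀ ω, 0 ≤ φ' ω) :
    samplingRatio φ φ' c = 0 := by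
  simp [samplingRatio, h, hφ']

theorem samplingRatio_eq_zero_right {φ φ' c : Ω → ℝ} (h : ∀ ω, φ' ω = 0) (hφ : ∀ ω, 0 ≤ φ ω) :
    samplingRatio φ φ' c = 0 := by
  simp [samplingRatio, h, hφ]

theorem sum_max_mul_samplingRatio {φ φ' : Ω → ℝ} (hφ : ∀ ω, 0 ≤ φ ω) (hφ' : ∀ ω, 0 ≤ φ' ω)
    (c : Ω → ℝ) :
    (∑ ω, max (φ ω) (φ' ω)) * samplingRatio φ φ' c = ∑ ω, min (φ ω) (φ' ω) * c ω := by
  refine mul_div_cancel_of_imp' fun h => sum_eq_zero fun ω hω => ?_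
  have hmax := (sum_eq_zero_iff_of_nonneg fun ω _ => le_max_of_le_left (hφ ω)).1 h ω hω
  have hmin : min (φ ω) (φ' ω) = 0 :=
    le_antisymm (min_le_max.trans_eq hmax) (le_min (hφ ω) (hφ' ω))
  rw [hmin, zero_mul]

theorem exists_sampled_set [DecidableEq X] {φ : Ω → X → ℝ} (hφ : ∀ ω x, 0 ≤ φ ω x)
    (hφ₀ : ∃ ω, φ ω ≠ 0) (b : Ω → X → X → ℝ) :
    ∃ ω, ∃ S : Finset X, S.Nonempty ∧ (∀ x ∈ S, 0 < φ ω x) ∧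
      ∑ x, ∑ x', (if x ∈ S ∨ x' ∈ S then samplingRatio (φ · x) (φ · x') (b · x x') else 0) ≤
        ∑ x, ∑ x', if x ∈ S ∧ x' ∈ S then b ω x x' else 0 := by
  set R : X → X → ℝ := fun x x' => samplingRatio (φ · x) (φ · x') (b · x x')
  have sum_rotate : ∀ f : Ω → X → X → ℝ, ∑ ω, ∑ x, ∑ x', f ω x x' = ∑ x, ∑ x', ∑ ω, f ω x x' :=
    fun f => sum_comm.trans (sum_congr rfl fun x _ => sum_comm)
  have htotal : ∑ ω, ∑ x, ∑ x', max (φ ω x) (φ ω x') * R x x' =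
      ∑ ω, ∑ x, ∑ x', min (φ ω x) (φ ω x') * b ω x x' := by
    rw [sum_rotate, sum_rotate]
    refine sum_congr rfl fun x _ => sum_congr rfl fun x' _ => ?_
    rw [← sum_mul]
    exact sum_max_mul_samplingRatio (hφ · x) (hφ · x') _
  obtain ⟨ω, hω, hle⟩ : ∃ ω, φ ω ≠ 0 ∧ ∑ x, ∑ x', max (φ ω x) (φ ω x') * R x x' ≤
      ∑ x, ∑ x', min (φ ω x) (φ ω x') * b ω x x' := by
    by_contra! hlt
    obtain ⟨ω₀, hω₀⟩ := hφ₀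
    refine htotal.not_gt (sum_lt_sum (fun ω _ => ?_) ⟨ω₀, mem_univ _, hlt ω₀ hω₀⟩)
    by_cases hω : φ ω = 0
    · simp [hω]
    · exact (hlt ω hω).le
  exact ⟨ω, exists_layer_sum_le R (b ω) (hφ ω) hω hle⟩

theorem IsProjectionKernel.add_collisionValue_le_piecewise [DecidableEq X]
    (hK : IsProjectionKernel K e) {p q : X → A → ℝ} (hp : IsFractionalLabelling p)
    (hq : IsFractionalLabelling q) {S : Finset X} (hqS : ∀ x ∈ S, q x = 0) :
    ∑ x, ∑ x', (if x ∈ S ∧ x' ∈ S then agreement K p x x' else 0) + collisionValue K q ≤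
      collisionValue K (S.piecewise p q) := by
  simp only [collisionValue_eq_sum_agreement, ← sum_add_distrib]
  refine sum_le_sum fun x _ => sum_le_sum fun x' _ => ?_
  have hnonneg := hK.agreement_nonneg (hp.piecewise hq S).nonneg x x'
  by_cases hx : x ∈ S
  · rw [agreement_eq_zero_left (hqS x hx), add_zero]
    split_ifs with h
    · exact (agreement_congr (by simp [h.1]) (by simp [h.2])).le
    · exact hnonneg
  by_cases hx' : x' ∈ S
  · simpa [hx, agreement_eq_zero_right (hqS x' hx')] using hnonneg
  · rw [if_neg (by simp [hx]), zero_add]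
    exact (agreement_congr (by simp [hx]) (by simp [hx'])).le

theorem IsProjectionKernel.exists_labelling_sum_samplingRatio_le (hK : IsProjectionKernel K e)
    {p : Ω → X → A → ℝ} (hp : ∀ ω, IsFractionalLabelling (p ω)) (φ : Ω → X → ℝ)
    (hφ : ∀ ω x, 0 ≤ φ ω x) :
    ∃ q, IsFractionalLabelling q ∧ (∀ x, (∀ ω, φ ω x = 0) → q x = 0) ∧
      ∑ x, ∑ x', samplingRatio (φ · x) (φ · x') (fun ω => agreement K (p ω) x x') ≤
        collisionValue K q := by
  classical
  induction h : #{x | ∃ ω, φ ω x ≠ 0} using Nat.strong_induction_on generalizing φ with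
  | _ N ih =>
    subst h
    rcases forall_or_exists_not fun ω => φ ω = 0 with hφ₀ | hφ₀
    · exact ⟨0, ⟨by simp, by simp [labelMass]⟩, fun _ _ => rfl,
        by simp [samplingRatio, hφ₀, collisionValue, gameOp, answerWeight]⟩
    obtain ⟨ω, S, ⟨x₀, hx₀⟩, hS, hgain⟩ := exists_sampled_set hφ hφ₀ fun ω => agreement K (p ω)
    let φ' : Ω → X → ℝ := fun ω x => if x ∈ S then 0 else φ ω x
    have hφ'S : ∀ x ∈ S, ∀ ω, φ' ω x = 0 := fun x hx ω => if_pos hx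
    have hφ' : ∀ ω x, 0 ≤ φ' ω x := fun ω x => by dsimp only [φ']; split_ifs <;> simp [hφ]
    have hcard : #{x | ∃ ω, φ' ω x ≠ 0} < #{x | ∃ ω, φ ω x ≠ 0} := by
      refine card_lt_card ((ssubset_iff_of_subset fun x hx => ?_).2 ⟨x₀, ?_, ?_⟩)
      · obtain ⟨ω, hω⟩ := (mem_filter.1 hx).2
        exact mem_filter.2 ⟨mem_univ x, ω, fun h => hω (by simp [φ', h])⟩
      · exact mem_filter.2 ⟨mem_univ _, ω, (hS x₀ hx₀).ne'⟩
      · simp [φ', hx₀]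
    obtain ⟨q, hq, hq₀, hsum⟩ := ih _ hcard φ' hφ' rfl
    refine ⟨S.piecewise (p ω) q, (hp ω).piecewise hq S, fun x hx => ?_, ?_⟩
    · have hxS : x ∉ S := fun hxS => (hS x hxS).ne' (hx ω)
      rw [piecewise_eq_of_notMem _ _ _ hxS]
      exact hq₀ x fun ω => by simp [φ', hx ω]
    refine le_trans ?_ (hK.add_collisionValue_le_piecewise (hp ω) hq fun x hx => hq₀ x (hφ'S x hx))
    refine le_trans (le_of_eq ?_) (add_le_add hgain hsum)
    simp only [← sum_add_distrib]
    refine sum_congr rfl fun x _ => sum_congr rfl fun x' _ => ?_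
    by_cases hx : x ∈ S
    · rw [if_pos (.inl hx), samplingRatio_eq_zero_left (hφ'S x hx) (hφ' · x'), add_zero]
    by_cases hx' : x' ∈ S
    · rw [if_pos (.inr hx'), samplingRatio_eq_zero_right (hφ'S x' hx') (hφ' · x), add_zero]
    · simp [φ', hx, hx']

theorem IsProjectionKernel.exists_labelling_of_vector (hK : IsProjectionKernel K e)
    {F : Ω → X → A → ℝ} (hF : ∀ ω x a, 0 ≤ F ω x a) {φ : Ω → X → ℝ} (hφ : ∀ ω x, 0 ≤ φ ω x) :
    ∃ q, IsFractionalLabelling q ∧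
      ∑ x, ∑ x', samplingRatio (φ · x) (φ · x') (fun ω =>
        agreement K (F ω) x x' / (labelMass (F ω) x * labelMass (F ω) x')) ≤
        collisionValue K q := by
  obtain ⟨q, hq, -, hsum⟩ := hK.exists_labelling_sum_samplingRatio_le
    (p := fun ω x a => F ω x a / labelMass (F ω) x) (fun ω => {
      nonneg := fun x a => div_nonneg (hF ω x a) (labelMass_nonneg (hF ω) x)
      labelMass_le := fun x => by
        simp only [labelMass, ← sum_div]
        exact div_self_le_one _ }) φ hφ
  simp only [agreement_div] at hsum
  exact ⟨q, hq, hsum⟩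

end CorrelatedSampling

section QuadraticRounding

variable {X Y A B Ω : Type*} [Fintype X] [Fintype Y] [Fintype A] [Fintype B] [Fintype Ω]
  {K : X → A → Y → B → ℝ} {e : Matrix X Y ℝ} {d : ℝ}

theorem samplingRatio_nonneg {φ φ' c : Ω → ℝ} (hφ : ∀ ω, 0 ≤ φ ω) (hφ' : ∀ ω, 0 ≤ φ' ω)
    (hc : ∀ ω, 0 ≤ c ω) : 0 ≤ samplingRatio φ φ' c :=
  div_nonneg (sum_nonneg fun ω _ => mul_nonneg (le_min (hφ ω) (hφ' ω)) (hc ω))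
    (sum_nonneg fun ω _ => le_max_of_le_left (hφ ω))

theorem sum_collisionValue (K : X → A → Y → B → ℝ) (F : Ω → X → A → ℝ) :
    ∑ ω, collisionValue K (F ω) = ∑ x, ∑ x', ∑ ω, agreement K (F ω) x x' := by
  simp only [collisionValue_eq_sum_agreement]
  exact sum_comm.trans (sum_congr rfl fun x _ => sum_comm)

theorem sq_sum_le_mul_samplingRatio {g g' c : Ω → ℝ} {m : ℝ} (hg : ∀ ω, 0 ≤ g ω)
    (hg' : ∀ ω, 0 ≤ g' ω) (hc : ∀ ω, 0 ≤ c ω) (hm : 0 ≤ m) (hcm : ∀ ω, c ω ≤ m * (g ω * g' ω))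
    (h : ∑ ω, g ω ^ 2 ≤ 1) (h' : ∑ ω, g' ω ^ 2 ≤ 1) :
    (∑ ω, c ω) ^ 2 ≤
      4 * m * samplingRatio (g · ^ 2) (g' · ^ 2) fun ω => c ω / (g ω * g' ω) := by
  set R := samplingRatio (g · ^ 2) (g' · ^ 2) fun ω => c ω / (g ω * g' ω)
  set M := ∑ ω, max (g ω ^ 2) (g' ω ^ 2)
  have hratio : ∀ ω, 0 ≤ c ω / (g ω * g' ω) := fun ω =>
    div_nonneg (hc ω) (mul_nonneg (hg ω) (hg' ω))
  have hR : 0 ≤ R := samplingRatio_nonneg (fun ω => sq_nonneg _) (fun ω => sq_nonneg _) hratio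
  have hM₀ : 0 ≤ M := sum_nonneg fun ω _ => le_max_of_le_left (sq_nonneg _)
  have hM : M ≤ 2 := calc
    M ≤ ∑ ω, (g ω ^ 2 + g' ω ^ 2) := sum_le_sum fun ω _ =>
      max_le (le_add_of_nonneg_right (sq_nonneg _)) (le_add_of_nonneg_left (sq_nonneg _))
    _ ≤ 2 := by rw [sum_add_distrib]; linarith
  have hMR : M * R = ∑ ω, min (g ω ^ 2) (g' ω ^ 2) * (c ω / (g ω * g' ω)) :=
    sum_max_mul_samplingRatio (fun ω => sq_nonneg _) (fun ω => sq_nonneg _) _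
  have hcauchy : (∑ ω, c ω) ^ 2 ≤ M * R * (m * M) := by
    rw [hMR, mul_sum univ _ m]
    refine sum_sq_le_sum_mul_sum_of_sq_le_mul _
      (fun ω _ => mul_nonneg (le_min (sq_nonneg _) (sq_nonneg _)) (hratio ω))
      (fun ω _ => mul_nonneg hm (le_max_of_le_left (sq_nonneg _))) fun ω _ => ?_
    have hcancel : g ω * g' ω * (c ω / (g ω * g' ω)) = c ω :=
      mul_div_cancel_of_imp' fun h₀ => le_antisymm (by simpa [h₀] using hcm ω) (hc ω)
    calc c ω ^ 2 ≤ m * (g ω * g' ω) * c ω := by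
          rw [sq]; exact mul_le_mul_of_nonneg_right (hcm ω) (hc ω)
      _ = m * (g ω ^ 2 * g' ω ^ 2) * (c ω / (g ω * g' ω)) := by
          linear_combination -(m * (g ω * g' ω)) * hcancel
      _ = _ := by rw [← min_mul_max (g ω ^ 2)]; ring
  calc (∑ ω, c ω) ^ 2 ≤ M ^ 2 * (m * R) := hcauchy.trans_eq (by ring)
    _ ≤ 2 ^ 2 * (m * R) :=
        mul_le_mul_of_nonneg_right (pow_le_pow_left₀ hM₀ hM 2) (mul_nonneg hm hR)
    _ = 4 * m * R := by ring

theorem IsBiregular.sum_sum_codegree (he : IsBiregular e d) :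
    ∑ x, ∑ x', (e * eᵀ) x x' = Fintype.card X * d ^ 2 := by
  simp only [he.sum_codegree, sum_const, card_univ, nsmul_eq_mul]

theorem IsProjectionKernel.exists_labelling_sq_collisionValue_le (hK : IsProjectionKernel K e)
    (he : IsBiregular e d) {F : Ω → X → A → ℝ} (hF : IsVectorLabelling F) :
    ∃ q, IsFractionalLabelling q ∧
      (∑ ω, collisionValue K (F ω)) ^ 2 ≤
        4 * (Fintype.card X * d ^ 2) * collisionValue K q := by
  have hg := fun ω => labelMass_nonneg (hF.nonneg ω)
  have hagree := fun ω => hK.agreement_nonneg (hF.nonneg ω)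
  let R : X × X → ℝ := fun z =>
    samplingRatio (fun ω => labelMass (F ω) z.1 ^ 2) (fun ω => labelMass (F ω) z.2 ^ 2) fun ω =>
      agreement K (F ω) z.1 z.2 / (labelMass (F ω) z.1 * labelMass (F ω) z.2)
  obtain ⟨q, hq, hsum⟩ := hK.exists_labelling_of_vector hF.nonneg
    (φ := fun ω x => labelMass (F ω) x ^ 2) fun ω x => sq_nonneg _
  refine ⟨q, hq, ?_⟩
  calc (∑ ω, collisionValue K (F ω)) ^ 2 = (∑ z : X × X, ∑ ω, agreement K (F ω) z.1 z.2) ^ 2 := by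
        rw [sum_collisionValue, Fintype.sum_prod_type]
    _ ≤ (∑ z : X × X, 4 * (e * eᵀ) z.1 z.2) * ∑ z, R z := by
        refine sum_sq_le_sum_mul_sum_of_sq_le_mul _
          (fun z _ => mul_nonneg zero_le_four (he.codegree_nonneg _ _))
          (fun z _ => samplingRatio_nonneg (fun ω => sq_nonneg _) (fun ω => sq_nonneg _)
            fun ω => div_nonneg (hagree ω _ _) (mul_nonneg (hg ω _) (hg ω _)))
          fun z _ => sq_sum_le_mul_samplingRatio (fun ω => hg ω _) (fun ω => hg ω _)
            (fun ω => hagree ω _ _) (he.codegree_nonneg _ _)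
            (fun ω => hK.agreement_le (hF.nonneg ω) _ _) (hF.sum_sq_le _) (hF.sum_sq_le _)
    _ = 4 * (Fintype.card X * d ^ 2) * ∑ x, ∑ x', R (x, x') := by
        rw [← mul_sum, Fintype.sum_prod_type, Fintype.sum_prod_type, he.sum_sum_codegree]
    _ ≤ 4 * (Fintype.card X * d ^ 2) * collisionValue K q :=
        mul_le_mul_of_nonneg_left hsum (by positivity)

end QuadraticRounding

section LinearRounding

variable {X Y A B Ω : Type*} [Fintype X] [Fintype Y] [Fintype A] [Fintype B] [Fintype Ω]
  {K : X → A → Y → B → ℝ} {e : Matrix X Y ℝ} {d ε γ : ℝ}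

namespace IsBiregular

theorem codegree_energy_eq (he : IsBiregular e d) (hd : d ≠ 0) (g : X → ℝ) :
    d ^ 2 * ∑ x, g x ^ 2 - ∑ y, (g ᵥ* e) y ^ 2 =
      d * ∑ x, ∑ y, e x y * (g x - (g ᵥ* e) y / d) ^ 2 := by
  set h : Y → ℝ := fun y => (g ᵥ* e) y / d
  have hge : ∀ y, (g ᵥ* e) y = d * h y := fun y => (mul_div_cancel₀ _ hd).symm
  have hgg : ∑ x, ∑ y, e x y * g x ^ 2 = d * ∑ x, g x ^ 2 := by
    simp only [← sum_mul, he.sum_row, mul_sum]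
  have hhh : ∑ x, ∑ y, e x y * h y ^ 2 = d * ∑ y, h y ^ 2 := by
    rw [sum_comm]
    simp only [← sum_mul, he.sum_col, mul_sum]
  have hgh : ∑ x, ∑ y, e x y * (g x * h y) = d * ∑ y, h y ^ 2 := by
    rw [sum_comm, mul_sum]
    refine sum_congr rfl fun y _ => ?_
    calc ∑ x, e x y * (g x * h y) = (g ᵥ* e) y * h y := by
          simp only [vecMul, dotProduct, sum_mul]
          exact sum_congr rfl fun x _ => by ring
      _ = d * h y ^ 2 := by rw [hge]; ring
  have hexpand : ∑ x, ∑ y, e x y * (g x - h y) ^ 2 = ∑ x, ∑ y, e x y * g x ^ 2 -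
      2 * ∑ x, ∑ y, e x y * (g x * h y) + ∑ x, ∑ y, e x y * h y ^ 2 := by
    simp only [mul_sum, ← sum_sub_distrib, ← sum_add_distrib]
    exact sum_congr rfl fun x _ => sum_congr rfl fun y _ => by ring
  have hsq : ∑ y, (g ᵥ* e) y ^ 2 = d ^ 2 * ∑ y, h y ^ 2 := by
    simp only [hge, mul_pow, mul_sum]
  rw [hsq, hexpand, hgg, hgh, hhh]
  ring

theorem sum_codegree_mul_abs_sub_le (he : IsBiregular e d) (f : X → ℝ) (h : Y → ℝ) :
    ∑ x, ∑ x', (e * eᵀ) x x' * |f x - f x'| ≤ 2 * d * ∑ x, ∑ y, e x y * |f x - h y| := by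
  have hfst : ∑ x, ∑ x', ∑ y, e x y * e x' y * |f x - h y| =
      d * ∑ x, ∑ y, e x y * |f x - h y| := by
    rw [mul_sum]
    refine sum_congr rfl fun x _ => ?_
    rw [sum_comm, mul_sum]
    refine sum_congr rfl fun y _ => ?_
    rw [← sum_mul, ← mul_sum, he.sum_col]
    ring
  have hsnd : ∑ x, ∑ x', ∑ y, e x y * e x' y * |f x' - h y| =
      d * ∑ x, ∑ y, e x y * |f x - h y| := by
    rw [sum_comm, ← hfst]
    exact sum_congr rfl fun x _ => sum_congr rfl fun x' _ => sum_congr rfl fun y _ => by ring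
  calc ∑ x, ∑ x', (e * eᵀ) x x' * |f x - f x'|
      ≤ ∑ x, ∑ x', ∑ y, (e x y * e x' y * |f x - h y| + e x y * e x' y * |f x' - h y|) := by
        refine sum_le_sum fun x _ => sum_le_sum fun x' _ => ?_
        simp only [mul_apply, transpose_apply, sum_mul]
        refine sum_le_sum fun y _ => ?_
        rw [← mul_add, abs_sub_comm (f x')]
        exact mul_le_mul_of_nonneg_left (abs_sub_le _ _ _)
          (mul_nonneg (he.nonneg x y) (he.nonneg x' y))
    _ = 2 * d * ∑ x, ∑ y, e x y * |f x - h y| := by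
        simp only [sum_add_distrib]
        rw [hfst, hsnd]
        ring

theorem sum_sum_one_sub_mul_codegree (he : IsBiregular e d) (f : X → ℝ) :
    ∑ x, ∑ x', (1 - f x) * (e * eᵀ) x x' = Fintype.card X * d ^ 2 - d ^ 2 * ∑ x, f x := by
  simp only [← mul_sum, he.sum_codegree, ← sum_mul, sum_sub_distrib, sum_const, card_univ,
    nsmul_eq_mul]
  ring

end IsBiregular

theorem sum_fromBlocks_mul (e : Matrix X Y ℝ) {f : X ⊕ Y → X ⊕ Y → ℝ}
    (hf : ∀ w w', f w w' = f w' w) :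
    ∑ w, ∑ w', fromBlocks 0 e eᵀ 0 w w' * f w w' =
      2 * ∑ x, ∑ y, e x y * f (.inl x) (.inr y) := by
  have h : ∑ y, ∑ x, e x y * f (.inr y) (.inl x) = ∑ x, ∑ y, e x y * f (.inl x) (.inr y) := by
    rw [sum_comm]
    simp only [hf (.inr _)]
  simp [Fintype.sum_sum_type, h, two_mul]

theorem mul_max_sub_min_mul_le {g g' f f' c m : ℝ} (hg : 0 ≤ g) (hg' : 0 ≤ g') (hf : 0 ≤ f)
    (hf' : 0 ≤ f') (hfg : f ≤ g ^ 2 / 2) (hfg' : f' ≤ g' ^ 2 / 2) (hcm : c ≤ m * (g * g')) :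
    m * max f f' - min f f' * (c / (g * g')) ≤
      m * |f - f'| + 1 / 2 * (m * (g * g') - c) := by
  have hmin₀ : 0 ≤ min f f' := le_min hf hf'
  have hmin : min f f' ≤ 1 / 2 * (g * g') := by
    rcases le_total g g' with h | h
    · exact (min_le_left _ _).trans (hfg.trans (by nlinarith))
    · exact (min_le_right _ _).trans (hfg'.trans (by nlinarith))
  suffices min f f' * m - min f f' * (c / (g * g')) ≤ 1 / 2 * (m * (g * g') - c) by
    rw [← max_sub_min_eq_abs']
    linarith
  rcases (mul_nonneg hg hg').eq_or_lt with h | h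
  · have : min f f' = 0 := le_antisymm (by simpa [← h] using hmin) hmin₀
    rw [this]
    linarith
  · generalize g * g' = z at h hmin hcm ⊢
    calc min f f' * m - min f f' * (c / z)
        = min f f' / z * (m * z - c) := by field_simp
      _ ≤ 1 / 2 * (m * z - c) :=
        mul_le_mul_of_nonneg_right ((div_le_iff₀ h).2 hmin) (sub_nonneg.2 hcm)

/-- If `∑ ω, g ω ^ 2` is small, the first summand on the right exceeds `m`; otherwise the
denominator of the sampling ratio is at least `ε / 32`. -/
theorem sub_samplingRatio_le {g g' φ φ' c : Ω → ℝ} {m : ℝ} (hε : 0 < ε) (hg : ∀ ω, 0 ≤ g ω)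
    (hg' : ∀ ω, 0 ≤ g' ω) (hc : ∀ ω, 0 ≤ c ω) (hm : 0 ≤ m) (hcm : ∀ ω, c ω ≤ m * (g ω * g' ω))
    (hφ : ∀ ω, ε / 16 * g ω ^ 2 ≤ φ ω ∧ φ ω ≤ g ω ^ 2 / 2)
    (hφ' : ∀ ω, ε / 16 * g' ω ^ 2 ≤ φ' ω ∧ φ' ω ≤ g' ω ^ 2 / 2) (h : ∑ ω, g ω ^ 2 ≤ 1) :
    m - samplingRatio φ φ' (fun ω => c ω / (g ω * g' ω)) ≤ 2 * ((1 - ∑ ω, g ω ^ 2) * m) +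
      32 / ε * (∑ ω, m * |φ ω - φ' ω| + 1 / 2 * ∑ ω, (m * (g ω * g' ω) - c ω)) := by
  set R := samplingRatio φ φ' fun ω => c ω / (g ω * g' ω)
  set D := ∑ ω, g ω ^ 2
  set M := ∑ ω, max (φ ω) (φ' ω)
  set Z := ∑ ω, m * |φ ω - φ' ω| + 1 / 2 * ∑ ω, (m * (g ω * g' ω) - c ω)
  have hφ₀ : ∀ ω, 0 ≤ φ ω := fun ω => (by positivity : 0 ≤ ε / 16 * g ω ^ 2).trans (hφ ω).1
  have hφ'₀ : ∀ ω, 0 ≤ φ' ω := fun ω => (by positivity : 0 ≤ ε / 16 * g' ω ^ 2).trans (hφ' ω).1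
  have hR : 0 ≤ R := samplingRatio_nonneg hφ₀ hφ'₀ fun ω =>
    div_nonneg (hc ω) (mul_nonneg (hg ω) (hg' ω))
  have hZ : 0 ≤ Z := add_nonneg (sum_nonneg fun ω _ => mul_nonneg hm (abs_nonneg _))
    (mul_nonneg one_half_pos.le (sum_nonneg fun ω _ => sub_nonneg.2 (hcm ω)))
  have hMZ : M * (m - R) ≤ Z := by
    rw [mul_sub, sum_max_mul_samplingRatio hφ₀ hφ'₀]
    simp only [M, Z, sum_mul, mul_sum, ← sum_sub_distrib, ← sum_add_distrib]
    refine sum_le_sum fun ω _ => ?_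
    rw [mul_comm _ m]
    exact mul_max_sub_min_mul_le (hg ω) (hg' ω) (hφ₀ ω) (hφ'₀ ω) (hφ ω).2 (hφ' ω).2 (hcm ω)
  have hMD : ε / 16 * D ≤ M := by
    rw [mul_sum]
    exact sum_le_sum fun ω _ => (hφ ω).1.trans (le_max_left _ _)
  have hDm : 0 ≤ (1 - D) * m := mul_nonneg (sub_nonneg.2 h) hm
  have hZε : 0 ≤ 32 / ε * Z := by positivity
  rcases le_total D (1 / 2) with hD | hD
  · nlinarith
  rcases le_total (m - R) 0 with hmR | hmR
  · linarith
  have hMε : ε / 32 ≤ M := le_trans (by nlinarith) hMD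
  suffices m - R ≤ 32 / ε * Z by linarith
  calc m - R = 32 / ε * (ε / 32 * (m - R)) := by field_simp
    _ ≤ 32 / ε * (M * (m - R)) := by gcongr
    _ ≤ 32 / ε * Z := by gcongr

theorem sum_labelMass_sub_agreement (K : X → A → Y → B → ℝ) (e : Matrix X Y ℝ)
    (F : Ω → X → A → ℝ) :
    ∑ x, ∑ x', ∑ ω,
        ((e * eᵀ) x x' * (labelMass (F ω) x * labelMass (F ω) x') - agreement K (F ω) x x') =
      ∑ ω, ∑ y, (labelMass (F ω) ᵥ* e) y ^ 2 - ∑ ω, collisionValue K (F ω) := by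
  simp only [sum_sub_distrib, sum_collisionValue, ← sum_codegree_mul_mul]
  rw [sum_comm (s := univ (α := Ω))]
  simp only [sum_comm (t := univ (α := Ω))]

theorem IsProjectionKernel.sum_sub_samplingRatio_le (hK : IsProjectionKernel K e)
    (he : IsBiregular e d) (hε : 0 < ε) {F : Ω → X → A → ℝ} (hF : IsVectorLabelling F)
    {φ : Ω → X → ℝ}
    (hφ : ∀ ω x, ε / 16 * labelMass (F ω) x ^ 2 ≤ φ ω x ∧ φ ω x ≤ labelMass (F ω) x ^ 2 / 2) :
    ∑ x, ∑ x', ((e * eᵀ) x x' - samplingRatio (φ · x) (φ · x') fun ω =>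
        agreement K (F ω) x x' / (labelMass (F ω) x * labelMass (F ω) x')) ≤
      2 * (Fintype.card X * d ^ 2 - d ^ 2 * ∑ x, ∑ ω, labelMass (F ω) x ^ 2) +
        32 / ε * (∑ x, ∑ x', ∑ ω, (e * eᵀ) x x' * |φ ω x - φ ω x'| +
          1 / 2 * (∑ ω, ∑ y, (labelMass (F ω) ᵥ* e) y ^ 2 - ∑ ω, collisionValue K (F ω))) := by
  have hg := fun ω => labelMass_nonneg (hF.nonneg ω)
  refine (sum_le_sum fun x _ => sum_le_sum fun x' _ => sub_samplingRatio_le hε (hg · x) (hg · x')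
    (fun ω => hK.agreement_nonneg (hF.nonneg ω) x x') (he.codegree_nonneg x x')
    (fun ω => hK.agreement_le (hF.nonneg ω) x x') (hφ · x) (hφ · x') (hF.sum_sq_le x)).trans_eq ?_
  rw [← he.sum_sum_one_sub_mul_codegree, ← sum_labelMass_sub_agreement]
  simp only [mul_sum, mul_add, sum_add_distrib]

variable [DecidableEq X] [DecidableEq Y]

theorem IsWeightedSmallSetExpander.isBiregular
    (hk : IsWeightedSmallSetExpander (fromBlocks 0 e eᵀ 0) d ε γ) : IsBiregular e d where
  nonneg x y := hk.nonneg (.inl x) (.inr y)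
  sum_row x := by simpa [Fintype.sum_sum_type] using hk.sum_eq (.inl x)
  sum_col y := by simpa [Fintype.sum_sum_type] using hk.sum_eq (.inr y)

/-- The weights with which a vertex selects an element of `Ω` must be comparable to `g ^ 2`, but
should rarely separate two vertices with a common neighbour. -/
theorem IsWeightedSmallSetExpander.exists_selection
    (hk : IsWeightedSmallSetExpander (fromBlocks 0 e eᵀ 0) d ε γ) (hd : 0 < d) (hε : 0 < ε)
    (hε₁ : ε ≤ 1) (hγ : 0 < γ) (hγ₁ : γ ≤ 1) {g : X → ℝ} (hg : ∀ x, 0 ≤ g x) :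
    ∃ φ : X → ℝ, (∀ x, ε / 16 * g x ^ 2 ≤ φ x ∧ φ x ≤ g x ^ 2 / 2) ∧
      ∑ x, ∑ x', (e * eᵀ) x x' * |φ x - φ x'| ≤
        8 / γ * (d ^ 2 * ∑ x, g x ^ 2 - ∑ y, (g ᵥ* e) y ^ 2) := by
  have he := hk.isBiregular
  set h : Y → ℝ := fun y => (g ᵥ* e) y / d
  obtain ⟨ψ, hψ, hcut⟩ := hk.exists_profile hε hε₁ hγ hγ₁ (Sum.elim g h)
  rw [energy, sum_fromBlocks_mul e fun w w' => abs_sub_comm _ _,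
    sum_fromBlocks_mul e fun w w' => sub_sq_comm _ _] at hcut
  simp only [Sum.elim_inl, Sum.elim_inr] at hcut
  refine ⟨fun x => ψ (g x), fun x => hψ _ (hg x), ?_⟩
  calc ∑ x, ∑ x', (e * eᵀ) x x' * |ψ (g x) - ψ (g x')|
      ≤ 2 * d * ∑ x, ∑ y, e x y * |ψ (g x) - ψ (h y)| :=
        he.sum_codegree_mul_abs_sub_le (fun x => ψ (g x)) fun y => ψ (h y)
    _ = d * (2 * ∑ x, ∑ y, e x y * |ψ (g x) - ψ (h y)|) := by ring
    _ ≤ d * (4 / γ * (2 * ∑ x, ∑ y, e x y * (g x - h y) ^ 2)) :=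
        mul_le_mul_of_nonneg_left hcut hd.le
    _ = 8 / γ * (d ^ 2 * ∑ x, g x ^ 2 - ∑ y, (g ᵥ* e) y ^ 2) := by
        rw [he.codegree_energy_eq hd.ne']; ring

theorem rounding_loss_le {ε γ P D H Q : ℝ} (hε : 0 < ε) (hε₁ : ε ≤ 1) (hγ : 0 < γ)
    (hγ₁ : γ ≤ 1) (hDP : D ≤ P) (hQH : Q ≤ H) :
    2 * (P - D) + 32 / ε * (8 / γ * (D - H) + 1 / 2 * (H - Q)) ≤ 256 / (ε * γ) * (P - Q) := by
  have hεγ : ε * γ ≤ 1 := mul_le_one₀ hε₁ hγ.le hγ₁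
  have hP : 2 ≤ 256 / (ε * γ) := by rw [le_div_iff₀ (by positivity)]; linarith
  have hHQ : 16 / ε ≤ 256 / (ε * γ) := by
    rw [div_le_div_iff₀ hε (by positivity)]
    nlinarith
  calc 2 * (P - D) + 32 / ε * (8 / γ * (D - H) + 1 / 2 * (H - Q))
      = 2 * (P - D) + 256 / (ε * γ) * (D - H) + 16 / ε * (H - Q) := by field_simp; ring
    _ ≤ 256 / (ε * γ) * (P - D) + 256 / (ε * γ) * (D - H) + 256 / (ε * γ) * (H - Q) :=
        add_le_add (add_le_add_left (mul_le_mul_of_nonneg_right hP (sub_nonneg.2 hDP)) _)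
          (mul_le_mul_of_nonneg_right hHQ (sub_nonneg.2 hQH))
    _ = 256 / (ε * γ) * (P - Q) := by ring

theorem IsProjectionKernel.exists_labelling_collisionValue_ge (hK : IsProjectionKernel K e)
    (hk : IsWeightedSmallSetExpander (fromBlocks 0 e eᵀ 0) d ε γ) (hd : 0 < d) (hε : 0 < ε)
    (hε₁ : ε ≤ 1) (hγ : 0 < γ) (hγ₁ : γ ≤ 1) {F : Ω → X → A → ℝ} (hF : IsVectorLabelling F) :
    ∃ q, IsFractionalLabelling q ∧
      Fintype.card X * d ^ 2 - collisionValue K q ≤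
        256 / (ε * γ) * (Fintype.card X * d ^ 2 - ∑ ω, collisionValue K (F ω)) := by
  have he := hk.isBiregular
  have hg := fun ω => labelMass_nonneg (hF.nonneg ω)
  choose φ hφ hcut using fun ω => hk.exists_selection hd hε hε₁ hγ hγ₁ (hg ω)
  obtain ⟨q, hq, hsum⟩ := hK.exists_labelling_of_vector hF.nonneg (φ := φ) fun ω x =>
    (by positivity : 0 ≤ ε / 16 * labelMass (F ω) x ^ 2).trans (hφ ω x).1
  refine ⟨q, hq, ?_⟩
  set P : ℝ := Fintype.card X * d ^ 2
  set Q := ∑ ω, collisionValue K (F ω)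
  set D := ∑ x, ∑ ω, labelMass (F ω) x ^ 2
  set H := ∑ ω, ∑ y, (labelMass (F ω) ᵥ* e) y ^ 2
  have hD : D ≤ Fintype.card X := by
    simpa using sum_le_sum fun x (_ : x ∈ univ) => hF.sum_sq_le x
  have hDP : d ^ 2 * D ≤ P :=
    (mul_comm _ _).trans_le (mul_le_mul_of_nonneg_right hD (sq_nonneg d))
  have hQH : Q ≤ H := by
    rw [← sub_nonneg, ← sum_labelMass_sub_agreement]
    exact sum_nonneg fun x _ => sum_nonneg fun x' _ => sum_nonneg fun ω _ =>
      sub_nonneg.2 (hK.agreement_le (hF.nonneg ω) x x')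
  have hcutsum : ∑ x, ∑ x', ∑ ω, (e * eᵀ) x x' * |φ ω x - φ ω x'| ≤
      8 / γ * (d ^ 2 * D - H) := by
    simp only [D, sum_comm (t := univ (α := Ω))]
    rw [mul_sum, ← sum_sub_distrib, mul_sum]
    exact sum_le_sum fun ω _ => hcut ω
  calc P - collisionValue K q
      ≤ ∑ x, ∑ x', ((e * eᵀ) x x' - samplingRatio (φ · x) (φ · x') fun ω =>
          agreement K (F ω) x x' / (labelMass (F ω) x * labelMass (F ω) x')) := by
        simp only [sum_sub_distrib]
        rw [he.sum_sum_codegree]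
        exact sub_le_sub_left hsum _
    _ ≤ 2 * (P - d ^ 2 * D) + 32 / ε *
          (∑ x, ∑ x', ∑ ω, (e * eᵀ) x x' * |φ ω x - φ ω x'| + 1 / 2 * (H - Q)) :=
        hK.sum_sub_samplingRatio_le he hε hF hφ
    _ ≤ 2 * (P - d ^ 2 * D) + 32 / ε * (8 / γ * (d ^ 2 * D - H) + 1 / 2 * (H - Q)) := by
        gcongr
    _ ≤ 256 / (ε * γ) * (P - Q) := rounding_loss_le hε hε₁ hγ hγ₁ hDP hQH

end LinearRounding

section Repetition

variable {X Y A B : Type*}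

/-- The payoff kernel of the `t`-fold repetition. -/
def tensorKernel (K : X → A → Y → B → ℝ) (t : ℕ) (x : Fin t → X) (a : Fin t → A)
    (y : Fin t → Y) (b : Fin t → B) : ℝ :=
  ∏ i, K (x i) (a i) (y i) (b i)

theorem tensorKernel_nonneg {K : X → A → Y → B → ℝ} (hK : ∀ x a y b, 0 ≤ K x a y b) (t : ℕ)
    (x : Fin t → X) (a : Fin t → A) (y : Fin t → Y) (b : Fin t → B) :
    0 ≤ tensorKernel K t x a y b :=
  prod_nonneg fun _ _ => hK _ _ _ _

variable [Fintype X]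

theorem sum_fin_cons {t : ℕ} (f : (Fin (t + 1) → X) → ℝ) :
    ∑ x, f x = ∑ x₀, ∑ x : Fin t → X, f (Fin.cons x₀ x) := by
  rw [← (Fin.consEquiv fun _ => X).sum_comp, Fintype.sum_prod_type]
  rfl

variable [Fintype A]

theorem gameOp_smul (K : X → A → Y → B → ℝ) (c : ℝ) (F : X → A → ℝ) (y : Y) (b : B) :
    gameOp K (c • F) y b = c * gameOp K F y b := by
  simp only [gameOp, answerWeight, mul_sum, Pi.smul_apply, smul_eq_mul, mul_left_comm]

theorem gameOp_sum {ι : Type*} (s : Finset ι) (K : X → A → Y → B → ℝ) (F : ι → X → A → ℝ) (y : Y)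
    (b : B) : gameOp K (fun x a => ∑ i ∈ s, F i x a) y b = ∑ i ∈ s, gameOp K (F i) y b := by
  simp only [gameOp, answerWeight, mul_sum]
  rw [sum_comm (s := s)]
  exact sum_congr rfl fun x _ => sum_comm

theorem gameOp_nonneg {K : X → A → Y → B → ℝ} (hK : ∀ x a y b, 0 ≤ K x a y b) {F : X → A → ℝ}
    (hF : ∀ x a, 0 ≤ F x a) (y : Y) (b : B) : 0 ≤ gameOp K F y b :=
  sum_nonneg fun _ _ => sum_nonneg fun _ _ => mul_nonneg (hK _ _ _ _) (hF _ _)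

/-- A labelling of the `(t + 1)`-fold repetition, contracted along the last `t` coordinates to a
family of labellings of the original game. -/
def contraction (K : X → A → Y → B → ℝ) {t : ℕ} (F : (Fin (t + 1) → X) → (Fin (t + 1) → A) → ℝ)
    (ω : (Fin t → Y) × (Fin t → B)) (x₀ : X) (a₀ : A) : ℝ :=
  gameOp (tensorKernel K t) (fun x a => F (Fin.cons x₀ x) (Fin.cons a₀ a)) ω.1 ω.2

theorem gameOp_tensorKernel_succ (K : X → A → Y → B → ℝ) {t : ℕ}
    (F : (Fin (t + 1) → X) → (Fin (t + 1) → A) → ℝ) (y₀ : Y) (y : Fin t → Y) (b₀ : B)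
    (b : Fin t → B) :
    gameOp (tensorKernel K (t + 1)) F (Fin.cons y₀ y) (Fin.cons b₀ b) =
      gameOp K (contraction K F (y, b)) y₀ b₀ := by
  simp only [gameOp, answerWeight, contraction, sum_fin_cons, tensorKernel, Fin.prod_univ_succ,
    Fin.cons_zero, Fin.cons_succ, mul_sum, mul_assoc]
  exact sum_congr rfl fun x₀ _ => sum_comm

variable [Fintype Y] [Fintype B]

theorem collisionValue_smul (K : X → A → Y → B → ℝ) (c : ℝ) (F : X → A → ℝ) :
    collisionValue K (c • F) = c ^ 2 * collisionValue K F := by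
  simp only [collisionValue, gameOp_smul, mul_pow, mul_sum]

theorem collisionValue_tensorKernel_succ (K : X → A → Y → B → ℝ) {t : ℕ}
    (F : (Fin (t + 1) → X) → (Fin (t + 1) → A) → ℝ) :
    collisionValue (tensorKernel K (t + 1)) F = ∑ ω, collisionValue K (contraction K F ω) := by
  simp only [collisionValue, sum_fin_cons, gameOp_tensorKernel_succ, Fintype.sum_prod_type]
  rw [sum_comm]
  refine sum_congr rfl fun y _ => ?_
  rw [sum_comm (s := univ (α := Fin t → B))]
  exact sum_congr rfl fun y₀ _ => sum_comm

theorem sum_sq_labelMass_contraction (K : X → A → Y → B → ℝ) {t : ℕ}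
    (F : (Fin (t + 1) → X) → (Fin (t + 1) → A) → ℝ) (x₀ : X) :
    ∑ ω, labelMass (contraction K F ω) x₀ ^ 2 =
      collisionValue (tensorKernel K t) fun x a => ∑ a₀, F (Fin.cons x₀ x) (Fin.cons a₀ a) := by
  simp only [labelMass, contraction, collisionValue, gameOp_sum, Fintype.sum_prod_type]

/-- By induction on `t`: contracting a labelling of the `(t + 1)`-fold repetition along `t`
coordinates gives a multiple of a vector labelling. -/
theorem collisionValue_tensorKernel_le_pow {K : X → A → Y → B → ℝ} (hK : ∀ x a y b, 0 ≤ K x a y b)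
    {κ : ℝ} (hκ₀ : 0 < κ)
    (hκ : ∀ (t : ℕ) (F : (Fin t → Y) × (Fin t → B) → X → A → ℝ), IsVectorLabelling F →
      ∑ ω, collisionValue K (F ω) ≤ κ) (t : ℕ)
    {F : (Fin t → X) → (Fin t → A) → ℝ} (hF : IsFractionalLabelling F) :
    collisionValue (tensorKernel K t) F ≤ κ ^ t := by
  induction t with
  | zero =>
    have hmass := hF.labelMass_le default
    simp only [labelMass, Fintype.sum_unique] at hmass
    simp only [collisionValue, gameOp, answerWeight, tensorKernel, Fintype.sum_unique,
      univ_eq_empty, prod_empty, one_mul, pow_zero]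
    exact pow_le_one₀ (hF.nonneg _ _) hmass
  | succ t ih =>
    have hpos : 0 < κ ^ t := pow_pos hκ₀ t
    set c := (√(κ ^ t))⁻¹
    have hc : c ^ 2 = (κ ^ t)⁻¹ := by rw [inv_pow, Real.sq_sqrt hpos.le]
    have hmass : ∀ x₀, ∑ ω, labelMass (contraction K F ω) x₀ ^ 2 ≤ κ ^ t := fun x₀ => by
      rw [sum_sq_labelMass_contraction]
      refine ih ⟨fun x a => sum_nonneg fun _ _ => hF.nonneg _ _, fun x => ?_⟩
      rw [labelMass, sum_comm, ← sum_fin_cons]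
      exact hF.labelMass_le _
    have hvector : IsVectorLabelling fun ω => c • contraction K F ω :=
      { nonneg := fun ω x a => mul_nonneg (by positivity) <|
          gameOp_nonneg (tensorKernel_nonneg hK t) (fun _ _ => hF.nonneg _ _) _ _
        sum_sq_le := fun x₀ => by
          simp only [labelMass, Pi.smul_apply, smul_eq_mul, ← mul_sum, mul_pow, hc]
          rw [inv_mul_le_iff₀ hpos, mul_one]
          exact hmass x₀ }
    have hbound := hκ t _ hvector
    simp only [collisionValue_smul, ← mul_sum, hc] at hbound
    rwa [inv_mul_le_iff₀ hpos, ← collisionValue_tensorKernel_succ, ← pow_succ] at hbound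

end Repetition

section Strategies

variable {X Y A B : Type*} [Fintype A]

theorem IsFractionalLabelling.pure [DecidableEq A] (f : X → A) :
    IsFractionalLabelling fun x => Pi.single (f x) (1 : ℝ) where
  nonneg x a := by
    rw [Pi.single_apply]
    split_ifs <;> norm_num
  labelMass_le x := by simp [labelMass]

variable [Fintype X] {K : X → A → Y → B → ℝ} {e : Matrix X Y ℝ} {d : ℝ} {q : X → A → ℝ}

theorem gameOp_pure [DecidableEq A] (K : X → A → Y → B → ℝ) (f : X → A) (y : Y) (b : B) :
    gameOp K (fun x => Pi.single (f x) 1) y b = ∑ x, K x (f x) y b := by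
  simp [gameOp, answerWeight, Pi.single_apply]

variable [Fintype Y]

theorem IsFractionalLabelling.exists_strategy_of_reply (hq : IsFractionalLabelling q)
    [Nonempty A] (hK : ∀ x a y b, 0 ≤ K x a y b) (g : Y → B) :
    ∃ f : X → A, ∑ y, gameOp K q y (g y) ≤ ∑ x, ∑ y, K x (f x) y (g y) := by
  choose f hf using fun x => Finite.exists_max fun a => ∑ y, K x a y (g y)
  refine ⟨f, ?_⟩
  simp only [gameOp, answerWeight]
  rw [sum_comm]
  refine sum_le_sum fun x _ => ?_
  calc ∑ y, ∑ a, K x a y (g y) * q x a = ∑ a, (∑ y, K x a y (g y)) * q x a := by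
        rw [sum_comm]
        simp only [sum_mul]
    _ ≤ ∑ a, (∑ y, K x (f x) y (g y)) * q x a :=
        sum_le_sum fun a _ => mul_le_mul_of_nonneg_right (hf x a) (hq.nonneg x a)
    _ = (∑ y, K x (f x) y (g y)) * labelMass q x := by rw [labelMass, mul_sum]
    _ ≤ ∑ y, K x (f x) y (g y) :=
        mul_le_of_le_one_right (sum_nonneg fun y _ => hK _ _ _ _) (hq.labelMass_le x)

variable [Fintype B]

theorem sq_sum_strategy_le [DecidableEq A] (K : X → A → Y → B → ℝ) (f : X → A) (g : Y → B) :
    (∑ x, ∑ y, K x (f x) y (g y)) ^ 2 ≤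
      Fintype.card Y * collisionValue K fun x => Pi.single (f x) 1 := by
  rw [sum_comm]
  simp only [← gameOp_pure, collisionValue]
  refine sq_sum_le_card_mul_sum_sq.trans (mul_le_mul_of_nonneg_left ?_ (Nat.cast_nonneg _))
  exact sum_le_sum fun y _ => single_le_sum
    (f := fun b => gameOp K (fun x => Pi.single (f x) 1) y b ^ 2)
    (fun b _ => sq_nonneg _) (mem_univ (g y))

theorem IsProjectionKernel.sum_gameOp_le (hK : IsProjectionKernel K e) (he : IsBiregular e d)
    (hq : IsFractionalLabelling q) (y : Y) : ∑ b, gameOp K q y b ≤ d := by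
  simp only [gameOp]
  rw [sum_comm, ← he.sum_col y]
  exact sum_le_sum fun x _ => (hK.sum_answerWeight_le hq.nonneg x y).trans
    (mul_le_of_le_one_right (he.nonneg x y) (hq.labelMass_le x))

theorem IsProjectionKernel.exists_reply (hK : IsProjectionKernel K e) (he : IsBiregular e d)
    (hq : IsFractionalLabelling q) [Nonempty B] :
    ∃ g : Y → B, collisionValue K q ≤ d * ∑ y, gameOp K q y (g y) := by
  have hop := fun y b => gameOp_nonneg hK.nonneg hq.nonneg y b
  choose g hg using fun y => Finite.exists_max fun b => gameOp K q y b
  refine ⟨g, ?_⟩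
  rw [collisionValue, mul_sum]
  refine sum_le_sum fun y _ => ?_
  calc ∑ b, gameOp K q y b ^ 2 ≤ ∑ b, gameOp K q y b * gameOp K q y (g y) :=
        sum_le_sum fun b _ => (sq _).trans_le (mul_le_mul_of_nonneg_left (hg y b) (hop y b))
    _ = (∑ b, gameOp K q y b) * gameOp K q y (g y) := by rw [sum_mul]
    _ ≤ d * gameOp K q y (g y) :=
        mul_le_mul_of_nonneg_right (hK.sum_gameOp_le he hq y) (hop y (g y))

end Strategies

theorem sum_ite_mem_eq_ncard {X Y : Type*} [Fintype X] [Fintype Y] (s : Set (X × Y))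
    [∀ x y, Decidable ((x, y) ∈ s)] :
    ∑ x, ∑ y, (if (x, y) ∈ s then (1 : ℝ) else 0) = s.ncard := by
  classical
  rw [← Fintype.sum_prod_type' (f := fun x y => if (x, y) ∈ s then (1 : ℝ) else 0), sum_boole,
    Set.ncard_eq_toFinset_card']
  congr 2
  ext
  simp

namespace TwoPlayerGame

variable {X Y A B : Type*} (Ψ : TwoPlayerGame X Y A B)

open Classical in
/-- The biadjacency matrix of the bipartite graph of question pairs. -/
noncomputable def edgeWeight : Matrix X Y ℝ :=
  fun x y => if (x, y) ∈ Ψ.edges then 1 else 0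

open Classical in
/-- The payoff kernel of a game: `1` on the accepted answers to question pairs. -/
noncomputable def payoff (x : X) (a : A) (y : Y) (b : B) : ℝ :=
  if (x, y) ∈ Ψ.edges ∧ Ψ.accept x y a b then 1 else 0

theorem IsProjection.isProjectionKernel [Fintype B] {Ψ : TwoPlayerGame X Y A B}
    (hΨ : Ψ.IsProjection) : IsProjectionKernel Ψ.payoff Ψ.edgeWeight where
  nonneg x a y b := by
    unfold payoff
    split_ifs <;> norm_num
  sum_le x a y := by
    classical
    by_cases h : (x, y) ∈ Ψ.edges
    · obtain ⟨π, hπ⟩ := hΨ x y h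
      simp only [payoff, edgeWeight, h, true_and, if_true, hπ, sum_boole]
      refine Nat.cast_le_one.2 (card_le_one.2 fun b hb b' hb' => ?_)
      exact Option.some_injective _ ((mem_filter.1 hb).2.symm.trans (mem_filter.1 hb').2)
    · simp [payoff, edgeWeight, h]

theorem winProb_le_one [Finite X] [Finite Y] (f : X → A) (g : Y → B) : Ψ.winProb f g ≤ 1 :=
  div_le_one_of_le₀ (Nat.cast_le.2 (Set.ncard_le_ncard (Set.sep_subset _ _) (Set.toFinite _)))
    (Nat.cast_nonneg _)

theorem value_nonneg : 0 ≤ Ψ.value :=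
  Real.iSup_nonneg fun _ => div_nonneg (Nat.cast_nonneg _) (Nat.cast_nonneg _)

theorem winProb_le_value [Finite X] [Finite Y] (f : X → A) (g : Y → B) :
    Ψ.winProb f g ≤ Ψ.value :=
  le_ciSup (f := fun s : (X → A) × (Y → B) => Ψ.winProb s.1 s.2)
    ⟨1, Set.forall_mem_range.2 fun s => Ψ.winProb_le_one s.1 s.2⟩ (f, g)

theorem value_repetition_of_edges_eq_empty [Finite X] [Finite Y] (hΨ : Ψ.edges = ∅) (t : ℕ) :
    (Ψ.repetition t).value ≤ 0 ^ t := by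
  refine Real.iSup_le (fun s => ?_) (by positivity)
  rcases t with _ | t
  · exact (winProb_le_one _ _ _).trans_eq (pow_zero 0).symm
  · simp [winProb, repetition, hΨ]

theorem payoff_repetition (t : ℕ) : (Ψ.repetition t).payoff = tensorKernel Ψ.payoff t := by
  classical
  funext x a y b
  simp only [payoff, tensorKernel, repetition, Set.mem_ofPred_eq, ← forall_and, prod_boole,
    mem_univ, true_imp_iff]

theorem ncard_edges_repetition (t : ℕ) : (Ψ.repetition t).edges.ncard = Ψ.edges.ncard ^ t := by
  let coordinates : (Ψ.repetition t).edges ≃ (Fin t → Ψ.edges) :=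
    { toFun := fun q i => ⟨(q.1.1 i, q.1.2 i), q.2 i⟩
      invFun := fun p => ⟨(fun i => (p i).1.1, fun i => (p i).1.2), fun i => (p i).2⟩ }
  rw [← Nat.card_coe_set_eq, ← Nat.card_coe_set_eq, Nat.card_congr coordinates,
    Nat.card_fun, Nat.card_fin]

variable [Fintype X] [Fintype Y]

theorem winProb_eq (f : X → A) (g : Y → B) :
    Ψ.winProb f g = (∑ x, ∑ y, Ψ.payoff x (f x) y (g y)) / Ψ.edges.ncard := by
  classical
  rw [winProb, ← sum_ite_mem_eq_ncard]
  rfl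

variable {Ψ} {d : ℝ}

theorem ncard_edges_eq_card_left_mul (he : IsBiregular Ψ.edgeWeight d) :
    (Ψ.edges.ncard : ℝ) = Fintype.card X * d := by
  classical
  rw [← sum_ite_mem_eq_ncard]
  refine (sum_congr rfl fun x _ => he.sum_row x).trans ?_
  simp

theorem ncard_edges_eq_card_right_mul (he : IsBiregular Ψ.edgeWeight d) :
    (Ψ.edges.ncard : ℝ) = Fintype.card Y * d := by
  classical
  rw [← sum_ite_mem_eq_ncard, sum_comm]
  refine (sum_congr rfl fun y _ => he.sum_col y).trans ?_
  simp

variable [Fintype A] [Fintype B]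

theorem collisionValue_le_value (hΨ : Ψ.IsProjection) (he : IsBiregular Ψ.edgeWeight d)
    (hd : 0 ≤ d) (hne : Ψ.edges.Nonempty) {q : X → A → ℝ} (hq : IsFractionalLabelling q) :
    collisionValue Ψ.payoff q ≤ Ψ.value * (Fintype.card X * d ^ 2) := by
  have hnonneg : 0 ≤ Ψ.value * (Fintype.card X * d ^ 2) :=
    mul_nonneg Ψ.value_nonneg (by positivity)
  rcases isEmpty_or_nonempty A with hA | hA
  · simpa [collisionValue, gameOp, answerWeight] using hnonneg
  rcases isEmpty_or_nonempty B with hB | hB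
  · simpa [collisionValue] using hnonneg
  have hK := hΨ.isProjectionKernel
  obtain ⟨g, hg⟩ := hK.exists_reply he hq
  obtain ⟨f, hf⟩ := hq.exists_strategy_of_reply hK.nonneg g
  have hwin : ∑ x, ∑ y, Ψ.payoff x (f x) y (g y) ≤ Ψ.value * Ψ.edges.ncard := by
    rw [← div_le_iff₀ (Nat.cast_pos.2 hne.ncard_pos), ← winProb_eq]
    exact Ψ.winProb_le_value f g
  calc collisionValue Ψ.payoff q ≤ d * ∑ y, gameOp Ψ.payoff q y (g y) := hg
    _ ≤ d * (Ψ.value * Ψ.edges.ncard) := mul_le_mul_of_nonneg_left (hf.trans hwin) hd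
    _ = Ψ.value * (Fintype.card X * d ^ 2) := by rw [ncard_edges_eq_card_left_mul he]; ring

theorem value_repetition_le {r : ℝ} (he : IsBiregular Ψ.edgeWeight d) (hr : 0 ≤ r)
    (hne : Ψ.edges.Nonempty) (t : ℕ)
    (h : ∀ F, IsFractionalLabelling F →
      collisionValue (tensorKernel Ψ.payoff t) F ≤ (r ^ 2 * (Fintype.card X * d ^ 2)) ^ t) :
    (Ψ.repetition t).value ≤ r ^ t := by
  classical
  refine Real.iSup_le (fun ⟨f, g⟩ => ?_) (pow_nonneg hr t)
  have hpos : (0 : ℝ) < Ψ.edges.ncard := Nat.cast_pos.2 hne.ncard_pos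
  rw [winProb_eq, ncard_edges_repetition, Nat.cast_pow, div_le_iff₀ (pow_pos hpos t),
    payoff_repetition]
  refine le_of_sq_le_sq ?_ (by positivity)
  calc (∑ x, ∑ y, tensorKernel Ψ.payoff t x (f x) y (g y)) ^ 2
      ≤ Fintype.card (Fin t → Y) *
          collisionValue (tensorKernel Ψ.payoff t) fun x => Pi.single (f x) 1 :=
        sq_sum_strategy_le _ f g
    _ ≤ Fintype.card (Fin t → Y) * (r ^ 2 * (Fintype.card X * d ^ 2)) ^ t :=
        mul_le_mul_of_nonneg_left (h _ (.pure f)) (Nat.cast_nonneg _)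
    _ = (r ^ 2 * ((Fintype.card X * d) * (Fintype.card Y * d))) ^ t := by
        rw [Fintype.card_fun, Fintype.card_fin, Nat.cast_pow, ← mul_pow]
        congr 1
        ring
    _ = (r ^ t * Ψ.edges.ncard ^ t) ^ 2 := by
        rw [← ncard_edges_eq_card_left_mul he, ← ncard_edges_eq_card_right_mul he]
        ring

end TwoPlayerGame

section Exponent

theorem le_rpow_quarter_of_sq_le {s ρ : ℝ} (hs : 0 < s) (hs' : s ≤ 1 / 16) (h : ρ ^ 2 ≤ 4 * s) :
    ρ ≤ s ^ (1 / 4 : ℝ) := by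
  have hsqrt : √s ≤ 1 / 4 := (Real.sqrt_le_left (by norm_num)).2 (by linarith)
  have hquarter : (s ^ (1 / 4 : ℝ)) ^ 2 = √s := by
    rw [← Real.rpow_mul_natCast hs.le, Real.sqrt_eq_rpow]
    norm_num
  refine le_of_sq_le_sq ?_ (by positivity)
  rw [hquarter]
  nlinarith [Real.sq_sqrt hs.le, Real.sqrt_nonneg s]

theorem one_sub_mul_le_rpow {δ c : ℝ} (hδ : 0 < δ) (hδ' : 1 / 16 ≤ 1 - δ) (hc : 0 ≤ c) :
    1 - 16 * δ * c ≤ (1 - δ) ^ c := by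
  have hs : 0 < 1 - δ := by linarith
  have hinv : (1 - δ)⁻¹ ≤ 16 := by
    rw [inv_le_comm₀ hs (by norm_num)]
    linarith
  have hlog : -(16 * δ) ≤ Real.log (1 - δ) := calc
    -(16 * δ) ≤ -((1 - δ)⁻¹ * δ) := neg_le_neg (mul_le_mul_of_nonneg_right hinv hδ.le)
    _ = 1 - (1 - δ)⁻¹ := by field_simp; ring
    _ ≤ Real.log (1 - δ) := Real.one_sub_inv_le_log_of_pos hs
  rw [Real.rpow_def_of_pos hs]
  calc 1 - 16 * δ * c = -(16 * δ) * c + 1 := by ring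
    _ ≤ Real.log (1 - δ) * c + 1 := by gcongr
    _ ≤ Real.exp (Real.log (1 - δ) * c) := Real.add_one_le_exp _

/-- The two bounds on `ρ` are those of the two rounding procedures: the quadratic one is needed
when `1 - δ` is close to `0`, the linear one otherwise. -/
theorem le_sq_rpow_of_le {δ τ ρ : ℝ} (hδ : 0 < δ) (hδ₁ : δ < 1) (hτ : 0 ≤ τ) (hτ₁ : τ ≤ 1)
    (hquadratic : ρ ^ 2 ≤ 4 * (1 - δ)) (hlinear : ρ ≤ 1 - δ * τ / 256) :
    ρ ≤ ((1 - δ) ^ (1 / 8192 * τ)) ^ 2 := by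
  have hs : 0 < 1 - δ := sub_pos.2 hδ₁
  rw [← Real.rpow_mul_natCast hs.le]
  rcases le_total (1 - δ) (1 / 16) with h | h
  · refine (le_rpow_quarter_of_sq_le hs h hquadratic).trans
      (Real.rpow_le_rpow_of_exponent_ge hs (by linarith) ?_)
    push_cast
    linarith
  · refine (hlinear.trans_eq ?_).trans (one_sub_mul_le_rpow hδ h (by positivity))
    push_cast
    ring

theorem rpow_mul_le_rpow_cube_mul {s c ε γ t : ℝ} (hs : 0 < s) (hs₁ : s ≤ 1) (hc : 0 ≤ c)
    (hε : 0 ≤ ε) (hε₁ : ε ≤ 1) (hγ : 0 ≤ γ) (hγ₁ : γ ≤ 1) (ht : 0 ≤ t) :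
    s ^ (c * ε * γ * t) ≤ s ^ (c * ε ^ 3 * γ ^ 3 * t) := by
  refine Real.rpow_le_rpow_of_exponent_ge hs hs₁ ?_
  gcongr
  · exact pow_le_of_le_one hε hε₁ three_ne_zero
  · exact pow_le_of_le_one hγ hγ₁ three_ne_zero

end Exponent

theorem TwoPlayerGame.IsProjection.value_repetition_le {X Y A B : Type*} [Fintype X] [Fintype Y]
    [Finite A] [Finite B] [DecidableEq X] [DecidableEq Y] {Ψ : TwoPlayerGame X Y A B}
    (hΨ : Ψ.IsProjection) {d ε γ δ : ℝ} (hε : 0 < ε) (hε₁ : ε ≤ 1) (hγ : 0 < γ) (hγ₁ : γ ≤ 1)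
    (hδ : 0 < δ) (hδ₁ : δ < 1)
    (hk : IsWeightedSmallSetExpander (fromBlocks 0 Ψ.edgeWeight Ψ.edgeWeightᵀ 0) d ε γ)
    (hval : Ψ.value ≤ 1 - δ) (t : ℕ) :
    (Ψ.repetition t).value ≤ (1 - δ) ^ (1 / 8192 * (ε * γ) * t) := by
  have := Fintype.ofFinite A
  have := Fintype.ofFinite B
  have hs : 0 < 1 - δ := sub_pos.2 hδ₁
  rw [Real.rpow_mul_natCast hs.le]
  set r := (1 - δ) ^ (1 / 8192 * (ε * γ))
  have hr : 0 < r := Real.rpow_pos_of_pos hs _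
  rcases Ψ.edges.eq_empty_or_nonempty with hempty | hne
  · exact (value_repetition_of_edges_eq_empty _ hempty t).trans (pow_le_pow_left₀ le_rfl hr.le t)
  have hK := hΨ.isProjectionKernel
  have he := hk.isBiregular
  have hedges : (0 : ℝ) < Fintype.card X * d := by
    rw [← ncard_edges_eq_card_left_mul he]
    exact Nat.cast_pos.2 hne.ncard_pos
  have hd : 0 < d := pos_of_mul_pos_right hedges (Nat.cast_nonneg _)
  set P := Fintype.card X * d ^ 2 with hP_def
  have hP : 0 < P := by rw [hP_def, sq, ← mul_assoc]; positivity
  have hfractional : ∀ q, IsFractionalLabelling q → collisionValue Ψ.payoff q ≤ (1 - δ) * P :=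
    fun q hq => (collisionValue_le_value hΨ he hd.le hne hq).trans
      (mul_le_mul_of_nonneg_right hval hP.le)
  refine TwoPlayerGame.value_repetition_le he hr.le hne t fun F hF =>
    collisionValue_tensorKernel_le_pow hK.nonneg (by positivity) (fun t F hF => ?_) t hF
  rw [← div_le_iff₀ hP]
  refine le_sq_rpow_of_le hδ hδ₁ (by positivity) (mul_le_one₀ hε₁ hγ.le hγ₁) ?_ ?_
  · obtain ⟨q, hq, hQ⟩ := hK.exists_labelling_sq_collisionValue_le he hF
    rw [div_pow, div_le_iff₀ (by positivity)]
    calc (∑ ω, collisionValue Ψ.payoff (F ω)) ^ 2 ≤ 4 * P * collisionValue Ψ.payoff q := hQ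
      _ ≤ 4 * P * ((1 - δ) * P) := mul_le_mul_of_nonneg_left (hfractional q hq) (by positivity)
      _ = 4 * (1 - δ) * P ^ 2 := by ring
  · obtain ⟨q, hq, hQ⟩ := hK.exists_labelling_collisionValue_ge hk hd hε hε₁ hγ hγ₁ hF
    have hloss : δ * P ≤ 256 / (ε * γ) * (P - ∑ ω, collisionValue Ψ.payoff (F ω)) := by
      linarith [hfractional q hq]
    rw [div_mul_eq_mul_div, le_div_iff₀ (by positivity)] at hloss
    rw [div_le_iff₀ hP]
    linarith

section Graphs

theorem IsWeightedSmallSetExpander.doubleCover {W : Type*} [Fintype W] [DecidableEq W]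
    {k : Matrix W W ℝ} {d ε γ : ℝ} (hk : IsWeightedSmallSetExpander k d ε γ) :
    IsWeightedSmallSetExpander (fromBlocks 0 k kᵀ 0) d (ε / 2) γ where
  nonneg := by rintro (v | v) (w | w) <;> simp [hk.nonneg]
  symm := by rintro (v | v) (w | w) <;> simp
  sum_eq := by
    rintro (v | v)
    · simpa [Fintype.sum_sum_type] using hk.sum_eq v
    · simpa [Fintype.sum_sum_type, hk.symm _ v] using hk.sum_eq v
  le_cutWeight S hS := by
    set L := S.toLeft
    set R := S.toRight
    have hcard : #(L ∪ R) + #(L ∩ R) = #S := by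
      rw [card_union_add_card_inter, card_toLeft_add_card_toRight]
    have hS' : (#S : ℝ) ≤ ε * Fintype.card W := by
      rw [Fintype.card_sum, Nat.cast_add] at hS
      linarith
    have hunion := hk.le_cutWeight (L ∪ R) (le_trans (by exact_mod_cast (by lia)) hS')
    have hinter := hk.le_cutWeight (L ∩ R) (le_trans (by exact_mod_cast (by lia)) hS')
    have hcut : cutWeight (fromBlocks 0 k kᵀ 0) S =
        ∑ v, ∑ w, ((if v ∈ R ∧ w ∉ L then k v w else 0) +
          if v ∈ L ∧ w ∉ R then k v w else 0) := by
      simp [cutWeight, Fintype.sum_sum_type, sum_add_distrib, L, R, hk.symm]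
    have hsubmodular : cutWeight k (L ∪ R) + cutWeight k (L ∩ R) ≤
        cutWeight (fromBlocks 0 k kᵀ 0) S := by
      rw [hcut, cutWeight, cutWeight]
      simp only [← sum_add_distrib]
      refine sum_le_sum fun v _ => sum_le_sum fun w _ => ?_
      have := hk.nonneg v w
      by_cases v ∈ L <;> by_cases v ∈ R <;> by_cases w ∈ L <;> by_cases w ∈ R <;> simp_all
    calc γ * d * #S = γ * d * #(L ∪ R) + γ * d * #(L ∩ R) := by
          rw [← hcard, Nat.cast_add, mul_add]
      _ ≤ cutWeight (fromBlocks 0 k kᵀ 0) S := (add_le_add hunion hinter).trans hsubmodular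

variable {V : Type*} {G : SimpleGraph V} [DecidableRel G.Adj]

theorem UniqueGame.edgeWeight_game {A : Type*} (Ψ : UniqueGame G A) :
    Ψ.game.edgeWeight = G.adjMatrix ℝ := by
  ext u v
  simp only [TwoPlayerGame.edgeWeight, game, SimpleGraph.adjMatrix_apply, Set.mem_ofPred_eq]
  congr

variable [Fintype V] [G.LocallyFinite] {d : ℕ} {ε γ : ℝ}

theorem sum_adjMatrix (hG : G.IsRegularOfDegree d) (v : V) : ∑ w, G.adjMatrix ℝ v w = d := by
  simp only [SimpleGraph.adjMatrix_apply, sum_boole]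
  rw [← hG v, ← G.card_neighborFinset_eq_degree v]
  congr 2
  ext
  simp

variable [DecidableEq V]

theorem edgeExpansion_eq (hG : G.IsRegularOfDegree d) (S : Finset V) :
    edgeExpansion G S = cutWeight (G.adjMatrix ℝ) S / (d * #S) := by
  have hcut : cutWeight (G.adjMatrix ℝ) S =
      Set.ncard {p : V × V | G.Adj p.1 p.2 ∧ p.1 ∈ S ∧ p.2 ∉ S} := by
    rw [← sum_ite_mem_eq_ncard]
    simp only [cutWeight, SimpleGraph.adjMatrix_apply, ← ite_and, Set.mem_ofPred_eq, and_comm]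
  have hvolume : (d * #S : ℝ) = Set.ncard {p : V × V | G.Adj p.1 p.2 ∧ p.1 ∈ S} := by
    rw [← sum_ite_mem_eq_ncard]
    simp only [Set.mem_ofPred_eq, and_comm (b := _ ∈ S), ite_and, ← SimpleGraph.adjMatrix_apply]
    simp only [sum_ite_irrel, sum_adjMatrix hG, sum_const_zero, sum_ite_mem, univ_inter, sum_const,
      nsmul_eq_mul, mul_comm]
  rw [edgeExpansion, hcut, hvolume]

theorem IsSmallSetExpander.isWeightedSmallSetExpander (h : IsSmallSetExpander G ε γ)
    (hG : G.IsRegularOfDegree d) : IsWeightedSmallSetExpander (G.adjMatrix ℝ) d ε γ where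
  nonneg v w := by
    rw [SimpleGraph.adjMatrix_apply]
    split_ifs <;> norm_num
  symm v w := by simp only [SimpleGraph.adjMatrix_apply, G.adj_comm]
  sum_eq := sum_adjMatrix hG
  le_cutWeight S hS := by
    have hcut : 0 ≤ cutWeight (G.adjMatrix ℝ) S := sum_nonneg fun _ _ => sum_nonneg fun _ _ => by
      rw [SimpleGraph.adjMatrix_apply]
      split_ifs <;> norm_num
    rw [mul_assoc]
    rcases (by positivity : (0 : ℝ) ≤ d * #S).eq_or_lt with h₀ | hpos
    · rwa [← h₀, mul_zero]
    · have hS₀ : S.Nonempty := nonempty_of_ne_empty fun h => by simp [h] at hpos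
      rw [← le_div_iff₀ hpos, ← edgeExpansion_eq hG]
      exact h S hS₀ hS

theorem UniqueGame.isProjection_game {V A : Type*} {G : SimpleGraph V} (Ψ : UniqueGame G A) :
    Ψ.game.IsProjection := by
  classical
  intro u v huv
  refine ⟨fun a => if h : ∃ b, Ψ.constraint u v a b then some h.choose else none, fun a b => ?_⟩
  change Ψ.constraint u v a b ↔ (dite _ _ _) = some b
  constructor
  · intro hab
    have h : ∃ b, Ψ.constraint u v a b := ⟨b, hab⟩
    rw [dif_pos h]
    exact congrArg some (Ψ.right_unique u v huv a _ _ h.choose_spec hab)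
  · intro hab
    split_ifs at hab with h
    exact Option.some_injective _ hab ▸ h.choose_spec

theorem TwoPlayerGame.adjMatrix_graph {X Y A B : Type*} (Ψ : TwoPlayerGame X Y A B)
    [DecidableRel Ψ.graph.Adj] :
    Ψ.graph.adjMatrix ℝ = fromBlocks 0 Ψ.edgeWeight Ψ.edgeWeightᵀ 0 := by
  have adj_inl_inr (x y) : Ψ.graph.Adj (.inl x) (.inr y) ↔ (x, y) ∈ Ψ.edges := by simp [graph]
  have adj_inr_inl (y x) : Ψ.graph.Adj (.inr y) (.inl x) ↔ (x, y) ∈ Ψ.edges := by simp [graph]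
  classical
  ext (x | y) (x' | y') <;> rw [SimpleGraph.adjMatrix_apply]
  · simp [graph]
  · simp only [edgeWeight, fromBlocks_apply₁₂]
    exact if_congr (adj_inl_inr x y') rfl rfl
  · simp only [edgeWeight, fromBlocks_apply₂₁, transpose_apply]
    exact if_congr (adj_inr_inl y x') rfl rfl
  · simp [graph]

end Graphs

theorem theorem1p6_general :
    ∃ c : ℝ, 0 < c ∧
      ∀ ε γ δ : ℝ, 0 < ε → ε ≤ 1 → 0 < γ → γ ≤ 1 → 0 < δ → δ < 1 →
        (∀ (V A : Type*) [Fintype V] [Finite A] (G : SimpleGraph V) [G.LocallyFinite] (d : ℕ)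
            (Ψ : UniqueGame G A),
          G.IsRegularOfDegree d → IsSmallSetExpander G ε γ → Ψ.game.value ≤ 1 - δ →
          ∀ t : ℕ, (Ψ.game.repetition t).value ≤ (1 - δ) ^ (c * ε * γ * (t : ℝ))) ∧
        (∀ (X Y A B : Type*) [Fintype X] [Fintype Y] [Finite A] [Finite B]
            (Ψ : TwoPlayerGame X Y A B) [Ψ.graph.LocallyFinite] (d : ℕ),
          Ψ.IsProjection → Ψ.graph.IsRegularOfDegree d →
          IsSmallSetExpander Ψ.graph ε γ → Ψ.value ≤ 1 - δ →
          ∀ t : ℕ, (Ψ.repetition t).value ≤ (1 - δ) ^ (c * ε * γ * (t : ℝ))) := by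
  classical
  refine ⟨1 / 16384, by norm_num, fun ε γ δ hε hε₁ hγ hγ₁ hδ hδ₁ => ⟨?_, ?_⟩⟩
  · intro V A _ _ G _ d Ψ hG hexp hval t
    have hk := (hexp.isWeightedSmallSetExpander hG).doubleCover
    rw [← Ψ.edgeWeight_game] at hk
    refine (Ψ.isProjection_game.value_repetition_le (half_pos hε) (by linarith) hγ hγ₁ hδ hδ₁ hk
      hval t).trans_eq ?_
    congr 1
    ring
  · intro X Y A B _ _ _ _ Ψ _ d hΨ hG hexp hval t
    have hk := hexp.isWeightedSmallSetExpander hG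
    rw [Ψ.adjMatrix_graph] at hk
    refine (hΨ.value_repetition_le hε hε₁ hγ hγ₁ hδ hδ₁ hk hval t).trans
      (Real.rpow_le_rpow_of_exponent_ge (sub_pos.2 hδ₁) (by linarith) ?_)
    rw [mul_assoc (1 / 16384)]
    gcongr
    norm_num

theorem theorem1p6 :
    ∃ c : ℝ, 0 < c ∧
      ∀ ε γ δ : ℝ, 0 < ε → ε < 1 → 0 < γ → γ < 1 → 0 < δ → δ < 1 →
        -- Unique-Games instances on a regular small-set expander
        (∀ (V A : Type*) [Fintype V] [Finite A] (G : SimpleGraph V) [G.LocallyFinite] (d : ℕ)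
            (Ψ : UniqueGame G A),
          G.IsRegularOfDegree d → IsSmallSetExpander G ε γ → Ψ.game.value ≤ 1 - δ →
          ∀ t : ℕ, (Ψ.game.repetition t).value ≤ (1 - δ) ^ (c * ε ^ 3 * γ ^ 3 * (t : ℝ))) ∧
        -- projection games whose bipartite graph is a regular small-set expander
        (∀ (X Y A B : Type*) [Fintype X] [Fintype Y] [Finite A] [Finite B]
            (Ψ : TwoPlayerGame X Y A B) [Ψ.graph.LocallyFinite] (d : ℕ),
          Ψ.IsProjection → Ψ.graph.IsRegularOfDegree d →
          IsSmallSetExpander Ψ.graph ε γ → Ψ.value ≤ 1 - δ →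
          ∀ t : ℕ, (Ψ.repetition t).value ≤ (1 - δ) ^ (c * ε ^ 3 * γ ^ 3 * (t : ℝ))) := by
  obtain ⟨c, hc, h⟩ := theorem1p6_general
  refine ⟨c, hc, fun ε γ δ hε hε₁ hγ hγ₁ hδ hδ₁ => ?_⟩
  have hexponent (t : ℕ) := rpow_mul_le_rpow_cube_mul (t := t) (sub_pos.2 hδ₁)
    (sub_le_self 1 hδ.le) hc.le hε.le hε₁.le hγ.le hγ₁.le t.cast_nonneg
  obtain ⟨huniqueGames, hprojectionGames⟩ := h ε γ δ hε hε₁.le hγ hγ₁.le hδ hδ₁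
  exact ⟨fun V A _ _ G _ d Ψ hG hexp hval t =>
      (huniqueGames V A G d Ψ hG hexp hval t).trans (hexponent t),
    fun X Y A B _ _ _ _ Ψ _ d hΨ hG hexp hval t =>
      (hprojectionGames X Y A B Ψ d hΨ hG hexp hval t).trans (hexponent t)⟩
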